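/- Let $M\ge 1$ be an integer and let $\alpha_1,\dots,\alpha_M>0$ and $\beta_1,\dots,\beta_M>0$ be real numbers. Let $W_0$ be the nontrivial even solution in $L^2(\mathbb R)\cap C^2(\mathbb R)$ of $$W_0-\frac{1}{12}\Big(\sum_{m=1}^M\alpha_m m^4\Big)W_0''=\Big(\sum_{m=1}^M\beta_m m^3\Big)W_0^2 .$$ For $\eta>0$ put $(\mathcal A_\eta Y)(x)=\frac1\eta\int_{x-\eta/2}^{x+\eta/2}Y(\xi)\,d\xi$, and for $\varepsilon>0$ define $$\mathcal B_\varepsilon V=V+\sum_{m=1}^M\alpha_m m^2\,\frac{V-\mathcal A_{m\varepsilon}^2V}{\varepsilon^2},\qquad \mathcal M_\varepsilon V=2\sum_{m=1}^M\beta_m m^3\,\mathcal A_{m\varepsilon}\big((\mathcal A_{m\varepsilon}W_0)(\mathcal A_{m\varepsilon}V)\big),\qquad \mathcal L_\varepsilon=\mathcal B_\varepsilon-\mathcal M_\varepsilon .$$ Let $L^2_{\mathrm{even}}(\mathbb R)$ be the space of real-valued $V\in L^2(\mathbb R)$ with $V(-x)=V(x)$ for almost every $x$. Then there exist $\varepsilon_*\in(0,1]$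 and a constant $C$ (which may depend on $\varepsilon_*$, but not on $\varepsilon$) such that, for every $0<\varepsilon\le\varepsilon_*$, the operator $\mathcal L_\varepsilon$ maps $L^2_{\mathrm{even}}(\mathbb R)$ into itself, is continuously invertible there, and satisfies $$\|\mathcal L_\varepsilon^{-1}G\|_2\le C\,\|G\|_2\qquad\text{for all } G\in L^2_{\mathrm{even}}(\mathbb R).$$ -/

import Mathlib

open MeasureTheory

namespace KdVChain

noncomputable section

/-- The space `L²_even(ℝ)`: real-valued square integrable functions with `V (-x) = V x` for almost
every `x`, a linear subspace of `L²(ℝ)` with the `L²` norm. -/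
def evenL2 : Submodule ℝ (Lp ℝ 2 (volume : Measure ℝ)) where
  carrier := {V | ∀ᵐ x : ℝ, V (-x) = V x}
  zero_mem' := by
    have h := Lp.coeFn_zero ℝ 2 (volume : Measure ℝ)
    have h' := (Measure.measurePreserving_neg (volume : Measure ℝ)).quasiMeasurePreserving.ae h
    filter_upwards [h, h'] with x hx hx'
    rw [hx, hx']
    rfl
  add_mem' := by
    intro V W hV hW
    have h := Lp.coeFn_add V W
    have h' := (Measure.measurePreserving_neg (volume : Measure ℝ)).quasiMeasurePreserving.ae h
    change ∀ᵐ x : ℝ, (V + W) (-x) = (V + W) x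
    filter_upwards [h, h', hV, hW] with x hx hx' hVx hWx
    rw [hx, hx', Pi.add_apply, Pi.add_apply, hVx, hWx]
  smul_mem' := by
    intro c V hV
    have h := Lp.coeFn_smul c V
    have h' := (Measure.measurePreserving_neg (volume : Measure ℝ)).quasiMeasurePreserving.ae h
    change ∀ᵐ x : ℝ, (c • V) (-x) = (c • V) x
    filter_upwards [h, h', hV] with x hx hx' hVx
    rw [hx, hx', Pi.smul_apply, Pi.smul_apply, hVx]

/-- The averaging operator `(A_η Y)(x) = η⁻¹ ∫_{x-η/2}^{x+η/2} Y(ξ) dξ`. -/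
def opA (η : ℝ) (Y : ℝ → ℝ) (x : ℝ) : ℝ :=
  1 / η * ∫ ξ in (x - η / 2)..(x + η / 2), Y ξ

/-- The operator `B_ε = Id + ∑_{m=1}^M α_m m² (Id - A_{mε}²) / ε²`. -/
def opB (M : ℕ) (α : ℕ → ℝ) (ε : ℝ) (V : ℝ → ℝ) (x : ℝ) : ℝ :=
  V x + ∑ m ∈ Finset.Icc 1 M,
    α m * (m : ℝ) ^ 2 * ((V x - opA (m * ε) (opA (m * ε) V) x) / ε ^ 2)

/-- The operator `M_ε V = 2 ∑_{m=1}^M β_m m³ A_{mε} ((A_{mε} W₀) (A_{mε} V))`. -/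
def opM (M : ℕ) (β : ℕ → ℝ) (W₀ : ℝ → ℝ) (ε : ℝ) (V : ℝ → ℝ) (x : ℝ) : ℝ :=
  2 * ∑ m ∈ Finset.Icc 1 M,
    β m * (m : ℝ) ^ 3 * opA (m * ε) (fun y => opA (m * ε) W₀ y * opA (m * ε) V y) x

/-- The linearized operator `L_ε = B_ε - M_ε`. -/
def opL (M : ℕ) (α β : ℕ → ℝ) (W₀ : ℝ → ℝ) (ε : ℝ) (V : ℝ → ℝ) (x : ℝ) : ℝ :=
  opB M α ε V x - opM M β W₀ ε V x

/-- `W₀` is the KdV wave: the nontrivial even square integrable solution of the leading order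
problem `B₀ W₀ = Q₀[W₀]`, that is, of the second order differential equation
`W₀ - (∑ α_m m⁴ / 12) W₀'' = (∑ β_m m³) W₀²`. -/
structure IsKdVWave (M : ℕ) (α β : ℕ → ℝ) (W₀ : ℝ → ℝ) : Prop where
  contDiff : ContDiff ℝ 2 W₀
  memLp : MemLp W₀ 2 (volume : Measure ℝ)
  even : Function.Even W₀
  ne_zero : W₀ ≠ 0
  ode : ∀ x : ℝ,
    W₀ x - (∑ m ∈ Finset.Icc 1 M, α m * (m : ℝ) ^ 4) / 12 * deriv (deriv W₀) x
      = (∑ m ∈ Finset.Icc 1 M, β m * (m : ℝ) ^ 3) * W₀ x ^ 2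

end

end KdVChain

/-! ### The KdV profile: positivity, boundedness, decay and nondegeneracy at the origin -/

namespace KdVChain

open Set Filter Topology

/-! The limit of `L_ε` as ε → 0 is the KdV linearization `T ↦ T - c T'' - 2 b W T`, with c = Σ α_m
m⁴ / 12 and b = Σ β_m m³. Its kernel contains only the odd function W' among the relevant
directions, so it is bounded below on even functions. The proof transfers this bound to `L_ε`,
uniformly for small ε.

Limit problem (`IsWaveProfile.exists_integral_sq_le`). For even T and g = T - c T'' - 2bWT, the
Wronskian of T with W' controls T(0), because W''(0) ≠ 0; evenness gives T'(0) = 0. Gronwall then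
controls T on a bounded interval. Outside it W is small, and the energy identity closes the
estimate.

Transfer. The difference `A_η² - Id` is the second derivative of convolution with an explicit
nonnegative cubic kernel of mass η²/12. Hence `B_ε v = v - T''`, where T (`regularization`) is C²
and close to c v. Multiplying `L_ε v = G` by c shows that T solves the limit problem with right side
c G plus errors. All errors are controlled by the Lipschitz constant of W and by ‖v(· + s) - v‖ for
|s| ≤ Mε. The latter is O(ε)(‖v‖ + ‖G‖): the quadratic form of `B_ε` bounds ‖v‖² - ‖A_ε v‖², which
is the variance of the translates of v (`norm_sq_sub_norm_avg_sq_le`, `norm_translate_sub_le`). For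
small ε the errors are absorbed (`exists_forall_norm_le`).

Invertibility. `L_ε` is symmetric and commutes with reflection. A symmetric operator bounded below
on a Hilbert space has closed range with trivial orthogonal complement
(`exists_equiv_of_symmetric_of_le`). -/

/-- A Gronwall type estimate for `u'' = O(u) + g` on the half-line. -/
theorem sq_add_sq_le_exp_mul {u u' u'' g : ℝ → ℝ} {Q : ℝ}
    (hu : ∀ x, HasDerivAt u (u' x) x) (hu' : ∀ x, HasDerivAt u' (u'' x) x)
    (hg : Continuous g) (hQ0 : 0 ≤ Q) (hQ : ∀ x, |u'' x| ≤ Q * |u x| + |g x|) {x : ℝ} (hx : 0 ≤ x) :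
    u x ^ 2 + u' x ^ 2 ≤
      Real.exp ((Q + 2) * x) * (u 0 ^ 2 + u' 0 ^ 2 + ∫ y in (0 : ℝ)..x, g y ^ 2) := by
  -- The derivative of u² + u'² is at most (Q + 2)(u² + u'²) + g² by Young's inequality, so the
  -- weighted energy `ψ` decreases on x ≥ 0.
  set K := Q + 2 with hK
  let ψ : ℝ → ℝ := fun x => Real.exp (-(K * x)) * (u x ^ 2 + u' x ^ 2) - ∫ y in (0 : ℝ)..x, g y ^ 2
  have hψ : ∀ x, HasDerivAt ψ (Real.exp (-(K * x)) * (2 * u x * u' x + 2 * u' x * u'' x)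
      - K * Real.exp (-(K * x)) * (u x ^ 2 + u' x ^ 2) - g x ^ 2) x := by
    intro x
    have h1 : HasDerivAt (fun x => Real.exp (-(K * x))) (Real.exp (-(K * x)) * (-(K * 1))) x :=
      (((hasDerivAt_id x).const_mul K).neg).exp
    have h2 := ((hu x).pow 2).add ((hu' x).pow 2)
    have h3 : HasDerivAt (fun x => ∫ y in (0 : ℝ)..x, g y ^ 2) (g x ^ 2) x :=
      intervalIntegral.integral_hasDerivAt_right ((hg.pow 2).intervalIntegrable _ _)
        ((hg.pow 2).stronglyMeasurableAtFilter _ _) (hg.pow 2).continuousAt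
    refine ((h1.mul h2).sub h3).congr_deriv ?_
    simp only [Pi.add_apply, Pi.pow_apply]
    push_cast
    ring
  have hdiff : Differentiable ℝ ψ := fun x => (hψ x).differentiableAt
  have hanti : AntitoneOn ψ (Ici 0) := by
    refine antitoneOn_of_deriv_nonpos (convex_Ici 0) hdiff.continuous.continuousOn
      hdiff.differentiableOn ?_
    intro x hx
    rw [interior_Ici, mem_Ioi] at hx
    rw [(hψ x).deriv]
    have he : Real.exp (-(K * x)) ≤ 1 := by
      rw [Real.exp_le_one_iff]
      have : 0 ≤ K * x := by positivity
      linarith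
    have he0 := Real.exp_pos (-(K * x))
    have key : 2 * u x * u' x + 2 * u' x * u'' x ≤ K * (u x ^ 2 + u' x ^ 2) + g x ^ 2 := by
      have a1 : u' x * u'' x ≤ |u' x| * (Q * |u x| + |g x|) :=
        (le_abs_self _).trans ((abs_mul _ _).trans_le
          (mul_le_mul_of_nonneg_left (hQ x) (abs_nonneg _)))
      have a2 : u x * u' x ≤ |u x| * |u' x| := (le_abs_self _).trans (abs_mul _ _).le
      rw [← sq_abs (u x), ← sq_abs (u' x), ← sq_abs (g x)]
      nlinarith [sq_nonneg (|u x| - |u' x|), sq_nonneg (|u' x| - |g x|),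
        mul_nonneg hQ0 (sq_nonneg (|u x| - |u' x|)), sq_nonneg (|u x|)]
    nlinarith [mul_le_mul_of_nonneg_left key he0.le, sq_nonneg (g x),
      mul_le_mul_of_nonneg_right he (sq_nonneg (g x))]
  have h := hanti (mem_Ici.2 le_rfl) (mem_Ici.2 hx) hx
  simp only [ψ, mul_zero, neg_zero, Real.exp_zero, intervalIntegral.integral_same, sub_zero,
    one_mul] at h
  have he1 : Real.exp (K * x) * Real.exp (-(K * x)) = 1 := by
    rw [← Real.exp_add, add_neg_cancel, Real.exp_zero]
  have he2 : 1 ≤ Real.exp (K * x) := Real.one_le_exp (by positivity)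
  have hE := mul_le_mul_of_nonneg_left h (Real.exp_pos (K * x)).le
  calc u x ^ 2 + u' x ^ 2 = Real.exp (K * x) * Real.exp (-(K * x)) * (u x ^ 2 + u' x ^ 2) := by
        rw [he1, one_mul]
    _ ≤ _ := by linarith

theorem deriv_zero_of_even {f : ℝ → ℝ} (hf : Function.Even f) : deriv f 0 = 0 := by
  have h := deriv_comp_neg f (0 : ℝ)
  rw [show (fun x => f (-x)) = f from funext hf, neg_zero] at h
  linarith

/-- The nontrivial even solutions in `L²(ℝ) ∩ C²(ℝ)` of `W - c W'' = b W²`. -/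
structure IsWaveProfile (c b : ℝ) (W : ℝ → ℝ) : Prop where
  c_pos : 0 < c
  b_pos : 0 < b
  contDiff : ContDiff ℝ 2 W
  memLp : MemLp W 2 (volume : Measure ℝ)
  even : Function.Even W
  ne_zero : W ≠ 0
  ode : ∀ x : ℝ, W x - c * deriv (deriv W) x = b * W x ^ 2

/-- A square integrable function is not bounded away from zero on a set of infinite measure. -/
theorem exists_abs_lt_of_memLp {W : ℝ → ℝ} (hW : MemLp W 2 (volume : Measure ℝ)) {s : Set ℝ}
    (hsm : MeasurableSet s) (hs : volume s = ⊤) {r : ℝ} (hr : 0 < r) : ∃ x ∈ s, |W x| < r := by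
  by_contra! hcon
  have h1 : Integrable (fun x => W x ^ 2) volume := hW.integrable_sq
  have h2 : IntegrableOn (fun _ : ℝ => r ^ 2) s volume := by
    refine Integrable.mono' h1.integrableOn (by fun_prop) ?_
    filter_upwards [ae_restrict_mem hsm] with x hx
    rw [Real.norm_of_nonneg (by positivity), ← sq_abs (W x)]
    exact pow_le_pow_left₀ hr.le (hcon x hx) 2
  rw [integrableOn_const_iff] at h2
  rcases h2 with h2 | h2
  · have : r ^ 2 ≠ 0 := by positivity
    simp_all
  · simp [hs] at h2

namespace IsWaveProfile

variable {c b : ℝ} {W : ℝ → ℝ}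

theorem hasDerivAt (h : IsWaveProfile c b W) (x : ℝ) : HasDerivAt W (deriv W x) x :=
  ((h.contDiff.differentiable (by norm_num)) x).hasDerivAt

theorem continuous_deriv (h : IsWaveProfile c b W) : Continuous (deriv W) :=
  h.contDiff.continuous_deriv (by norm_num)

theorem hasDerivAt_deriv (h : IsWaveProfile c b W) (x : ℝ) :
    HasDerivAt (deriv W) ((W x - b * W x ^ 2) / c) x := by
  have h1 : ContDiff ℝ 1 (deriv W) :=
    (contDiff_succ_iff_deriv.1 (show ContDiff ℝ (1 + 1) W from h.contDiff)).2.2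
  have h2 := ((h1.differentiable (by norm_num)) x).hasDerivAt
  have h3 : deriv (deriv W) x = (W x - b * W x ^ 2) / c := by
    have := h.ode x
    have := h.c_pos
    field_simp
    linarith
  rwa [h3] at h2

theorem deriv_zero (h : IsWaveProfile c b W) : deriv W 0 = 0 :=
  deriv_zero_of_even h.even

/-- Minimum principle: where W is negative the equation forces W'' < 0, which is impossible at an
interior minimum. Square integrability supplies points on both sides of x where |W| is smaller than
|W x|, so a minimum between them is interior. -/
theorem nonneg (h : IsWaveProfile c b W) (x : ℝ) : 0 ≤ W x := by
  by_contra! hx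
  obtain ⟨y, hy, hWy⟩ := exists_abs_lt_of_memLp h.memLp measurableSet_Ioi
    (by simp : volume (Ioi x) = ⊤) (r := -W x) (by linarith)
  obtain ⟨z, hz, hWz⟩ := exists_abs_lt_of_memLp h.memLp measurableSet_Iio
    (by simp : volume (Iio x) = ⊤) (r := -W x) (by linarith)
  rw [abs_lt] at hWy hWz
  simp only [mem_Ioi, mem_Iio] at hy hz
  obtain ⟨m, hm, hmin⟩ := isCompact_Icc.exists_isMinOn (⟨x, hz.le, hy.le⟩ : (Icc z y).Nonempty)
    h.contDiff.continuous.continuousOn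
  have hmx : W m ≤ W x := hmin ⟨hz.le, hy.le⟩
  have hmz : z < m := lt_of_le_of_ne hm.1 (by rintro rfl; linarith)
  have hmy : m < y := lt_of_le_of_ne hm.2 (by rintro rfl; linarith)
  have hloc : IsLocalMin W m := hmin.isLocalMin (Icc_mem_nhds hmz hmy)
  have hneg : (W m - b * W m ^ 2) / c < 0 := by
    refine div_neg_of_neg_of_pos ?_ h.c_pos
    have := mul_nonneg h.b_pos.le (sq_nonneg (W m))
    linarith
  -- The second derivative test makes `m` a local maximum as well; W is then locally constant and
  -- W'' m = 0, a contradiction.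
  have hmax : IsLocalMax W m := isLocalMax_of_deriv_deriv_neg
    (by rw [(h.hasDerivAt_deriv m).deriv]; exact hneg) hloc.deriv_eq_zero
    h.contDiff.continuous.continuousAt
  have hconst : W =ᶠ[𝓝 m] fun _ => W m := by
    filter_upwards [hloc, hmax] with t h1 h2 using le_antisymm h2 h1
  have : deriv (deriv W) m = 0 := by
    rw [hconst.deriv.deriv_eq]
    simp
  rw [(h.hasDerivAt_deriv m).deriv] at this
  linarith

/-- The first integral `F` is conserved. Since W ≥ 0, its cubic term dominates for large W and
bounds W; W' is then bounded by the same identity. -/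
theorem exists_bound (h : IsWaveProfile c b W) :
    ∃ K : ℝ, 0 < K ∧ (∀ x, W x ≤ K) ∧ ∀ x, |deriv W x| ≤ K := by
  have hb := h.b_pos
  have hc := h.c_pos
  let F : ℝ → ℝ := fun x => c * deriv W x ^ 2 - W x ^ 2 + 2 * b / 3 * W x ^ 3
  have hF : ∀ x, HasDerivAt F 0 x := by
    intro x
    refine (((((h.hasDerivAt_deriv x).pow 2).const_mul c).sub ((h.hasDerivAt x).pow 2)).add
      (((h.hasDerivAt x).pow 3).const_mul (2 * b / 3))).congr_deriv ?_
    push_cast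
    field_simp
    ring
  have hconst : ∀ x, F x = F 0 := fun x =>
    is_const_of_deriv_eq_zero (fun x => (hF x).differentiableAt) (fun x => (hF x).deriv) x 0
  -- If W x > 1, then conservation gives (2b/3) W³ ≤ W² + |F 0| ≤ W² (1 + |F 0|); divide by W².
  set B := 1 + 3 / (2 * b) * (1 + |F 0|) with hB
  have hB1 : 1 ≤ B := by
    rw [hB]
    have : 0 ≤ 3 / (2 * b) * (1 + |F 0|) := by positivity
    linarith
  have hWB : ∀ x, W x ≤ B := by
    intro x
    by_cases h1 : W x ≤ 1
    · linarith
    · push Not at h1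
      have e1 : 2 * b / 3 * W x ^ 3 ≤ W x ^ 2 * (1 + |F 0|) := by
        have := hconst x
        simp only [F] at this
        have k1 := le_abs_self (F 0)
        have k2 : 0 ≤ c * deriv W x ^ 2 := by positivity
        have k3 : |F 0| ≤ W x ^ 2 * |F 0| := le_mul_of_one_le_left (abs_nonneg _) (by nlinarith)
        simp only [F] at k1 k3 ⊢
        linarith
      have e2 : 2 * b / 3 * W x ≤ 1 + |F 0| := by
        have : 0 < W x ^ 2 := by positivity
        refine le_of_mul_le_mul_left ?_ this
        linarith
      have e3 : W x ≤ 3 / (2 * b) * (1 + |F 0|) := by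
        calc W x = 3 / (2 * b) * (2 * b / 3 * W x) := by field_simp
          _ ≤ _ := mul_le_mul_of_nonneg_left e2 (by positivity)
      linarith
  have hp : ∀ x, deriv W x ^ 2 ≤ (B ^ 2 + |F 0|) / c := by
    intro x
    rw [le_div_iff₀ hc]
    have := hconst x
    have k1 := le_abs_self (F 0)
    have k2 : 0 ≤ 2 * b / 3 * W x ^ 3 := by have := h.nonneg x; positivity
    have k3 : W x ^ 2 ≤ B ^ 2 := pow_le_pow_left₀ (h.nonneg x) (hWB x) 2
    simp only [F] at this k1 ⊢
    linarith
  refine ⟨B + √((B ^ 2 + |F 0|) / c), by positivity, fun x => ?_, fun x => ?_⟩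
  · exact (hWB x).trans (le_add_of_nonneg_right (Real.sqrt_nonneg _))
  · exact (Real.abs_le_sqrt (hp x)).trans (le_add_of_nonneg_left (by linarith))

theorem integrable_sq (h : IsWaveProfile c b W) : Integrable (fun x => W x ^ 2) :=
  h.memLp.integrable_sq

/-- Integrate (W W')' = W'² + W W'' over [0, R]: the boundary term is bounded, and W W'' ≥ -(bK/c)
W² by the equation, with W² integrable. -/
theorem exists_integral_deriv_sq_le (h : IsWaveProfile c b W) :
    ∃ P : ℝ, 0 ≤ P ∧ ∀ R, 0 ≤ R → ∫ x in (0 : ℝ)..R, deriv W x ^ 2 ≤ P := by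
  obtain ⟨K, hK, hWK, hpK⟩ := h.exists_bound
  have hb := h.b_pos
  have hc := h.c_pos
  have hcW := h.contDiff.continuous
  have hcp := h.continuous_deriv
  refine ⟨K * K + b * K / c * ∫ x, W x ^ 2, ?_, fun R hR => ?_⟩
  · have : 0 ≤ ∫ x, W x ^ 2 := integral_nonneg fun x => sq_nonneg _
    positivity
  have hd : ∀ x, HasDerivAt (fun x => W x * deriv W x)
      (deriv W x ^ 2 + W x * ((W x - b * W x ^ 2) / c)) x := by
    intro x
    refine ((h.hasDerivAt x).mul (h.hasDerivAt_deriv x)).congr_deriv ?_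
    ring
  have hFTC := intervalIntegral.integral_eq_sub_of_hasDerivAt (a := 0) (b := R) (fun x _ => hd x)
    (Continuous.intervalIntegrable (by fun_prop) _ _)
  rw [intervalIntegral.integral_add (Continuous.intervalIntegrable (by fun_prop) _ _)
    (Continuous.intervalIntegrable (by fun_prop) _ _), h.deriv_zero, mul_zero, sub_zero] at hFTC
  have hbd : W R * deriv W R ≤ K * K :=
    (mul_le_mul_of_nonneg_left ((le_abs_self _).trans (hpK R)) (h.nonneg R)).trans
      (mul_le_mul_of_nonneg_right (hWK R) hK.le)
  have hlow : -(b * K / c * ∫ x in (0 : ℝ)..R, W x ^ 2) ≤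
      ∫ x in (0 : ℝ)..R, W x * ((W x - b * W x ^ 2) / c) := by
    rw [← intervalIntegral.integral_const_mul, ← intervalIntegral.integral_neg]
    refine intervalIntegral.integral_mono_on hR (Continuous.intervalIntegrable (by fun_prop) _ _)
      (Continuous.intervalIntegrable (by fun_prop) _ _) fun x _ => ?_
    have e : W x * ((W x - b * W x ^ 2) / c) + b * K / c * W x ^ 2
        = (W x ^ 2 + b * W x ^ 2 * (K - W x)) / c := by
      field_simp
      ring
    have : 0 ≤ (W x ^ 2 + b * W x ^ 2 * (K - W x)) / c := by
      have := sub_nonneg.2 (hWK x)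
      positivity
    linarith
  have hW2 : ∫ x in (0 : ℝ)..R, W x ^ 2 ≤ ∫ x, W x ^ 2 := by
    rw [intervalIntegral.integral_of_le hR]
    exact setIntegral_le_integral h.integrable_sq (Eventually.of_forall fun x => sq_nonneg _)
  have := mul_le_mul_of_nonneg_left hW2 (show 0 ≤ b * K / c by positivity)
  linarith

/-- On the half-line both W² and its derivative 2WW' are integrable, so W² tends to 0. -/
theorem tendsto_atTop (h : IsWaveProfile c b W) : Tendsto W atTop (𝓝 0) := by
  obtain ⟨P, hP0, hP⟩ := h.exists_integral_deriv_sq_le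
  have hcW := h.contDiff.continuous
  have hcp := h.continuous_deriv
  have hp : IntegrableOn (fun x => deriv W x ^ 2) (Ioi 0) := by
    refine integrableOn_Ioi_of_intervalIntegral_norm_bounded (b := id) (l := atTop) P 0
      (fun i => (hcp.pow 2).integrableOn_Ioc) tendsto_id ?_
    filter_upwards [eventually_ge_atTop 0] with R hR
    simpa using hP R hR
  have hWp : IntegrableOn (fun x => 2 * W x * deriv W x) (Ioi 0) := by
    refine Integrable.mono' (h.integrable_sq.integrableOn.add hp)
      (by fun_prop) (Eventually.of_forall fun x => ?_)
    rw [Real.norm_eq_abs, abs_le, Pi.add_apply]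
    constructor <;> nlinarith [sq_nonneg (W x + deriv W x), sq_nonneg (W x - deriv W x)]
  have hsq := tendsto_zero_of_hasDerivAt_of_integrableOn_Ioi (f := fun x => W x ^ 2) (a := 0)
    (fun x _ => (((h.hasDerivAt x).pow 2).congr_deriv (by push_cast; ring)))
    hWp h.integrable_sq.integrableOn
  have := hsq.sqrt
  simpa [Real.sqrt_sq (h.nonneg _)] using this

theorem exists_forall_le (h : IsWaveProfile c b W) {δ : ℝ} (hδ : 0 < δ) :
    ∃ R : ℝ, 0 < R ∧ ∀ x, R ≤ |x| → W x ≤ δ := by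
  obtain ⟨R, hR⟩ := eventually_atTop.1 (h.tendsto_atTop.eventually (gt_mem_nhds hδ))
  refine ⟨max R 1, by positivity, fun x hx => ?_⟩
  have h1 : W x = W |x| := by
    rcases abs_choice x with e | e <;> rw [e]
    exact (h.even x).symm
  rw [h1]
  exact (hR |x| ((le_max_left _ _).trans hx)).le

/-- Otherwise W 0 is an equilibrium value and W' 0 = 0, so uniqueness (Gronwall with g = 0, applied
to W - W 0) makes W constant, against nontriviality in L². The Wronskian argument divides by this
quantity, which is W''(0). -/
theorem deriv_deriv_zero_ne (h : IsWaveProfile c b W) : (W 0 - b * W 0 ^ 2) / c ≠ 0 := by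
  intro h0
  obtain ⟨K, hK, hWK, hpK⟩ := h.exists_bound
  have hb := h.b_pos
  have hc := h.c_pos
  have h0' : W 0 = b * W 0 ^ 2 := by
    rcases div_eq_zero_iff.1 h0 with e | e
    · linarith
    · exact absurd e hc.ne'
  have hconst : ∀ x, 0 ≤ x → W x = W 0 := by
    intro x hx
    have := sq_add_sq_le_exp_mul (u := fun x => W x - W 0) (u' := deriv W) (g := fun _ => 0)
      (Q := (1 + 2 * b * K) / c) (fun x => (h.hasDerivAt x).sub_const _) h.hasDerivAt_deriv
      continuous_const (by positivity) (fun x => ?_) hx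
    · simp only [sub_self, h.deriv_zero] at this
      norm_num at this
      nlinarith [sq_nonneg (W x - W 0), sq_nonneg (deriv W x)]
    · have e : (W x - b * W x ^ 2) / c = (1 - b * (W x + W 0)) / c * (W x - W 0) := by
        field_simp
        linear_combination h0'
      rw [e, abs_mul, abs_zero, add_zero, abs_div, abs_of_pos hc]
      gcongr
      rw [abs_le]
      have := h.nonneg x
      have := h.nonneg 0
      have := hWK x
      have := hWK 0
      constructor <;> nlinarith
  have hconst' : ∀ x, W x = W 0 := by
    intro x
    rcases le_total 0 x with hx | hx
    · exact hconst x hx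
    · rw [← h.even x]
      exact hconst _ (by linarith)
  have hne : W 0 ≠ 0 := fun e => h.ne_zero (funext fun x => (hconst' x).trans e)
  obtain ⟨x, -, hx⟩ := exists_abs_lt_of_memLp h.memLp MeasurableSet.univ (by simp)
    (abs_pos.2 hne)
  rw [hconst' x] at hx
  exact lt_irrefl _ hx

end IsWaveProfile

end KdVChain

/-! ### Lower bound for the KdV linearization on even functions -/

namespace KdVChain

open Set Filter Topology

theorem sq_intervalIntegral_mul_le {f g : ℝ → ℝ} (hf : Continuous f) (hg : Continuous g) {a b : ℝ}
    (hab : a ≤ b) :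
    (∫ x in a..b, f x * g x) ^ 2 ≤ (∫ x in a..b, f x ^ 2) * ∫ x in a..b, g x ^ 2 := by
  have key : ∀ t : ℝ, 0 ≤ (∫ x in a..b, f x ^ 2) * (t * t) + (2 * ∫ x in a..b, f x * g x) * t
      + ∫ x in a..b, g x ^ 2 := by
    intro t
    have h0 : 0 ≤ ∫ x in a..b, (t * f x + g x) ^ 2 :=
      intervalIntegral.integral_nonneg hab fun x _ => sq_nonneg _
    have h1 : ∫ x in a..b, (t * f x + g x) ^ 2 =
        ∫ x in a..b, (t * t * f x ^ 2 + 2 * t * (f x * g x) + g x ^ 2) := by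
      congr 1 with x
      ring
    rw [h1, intervalIntegral.integral_add (Continuous.intervalIntegrable (by fun_prop) _ _)
      (Continuous.intervalIntegrable (by fun_prop) _ _),
      intervalIntegral.integral_add (Continuous.intervalIntegrable (by fun_prop) _ _)
      (Continuous.intervalIntegrable (by fun_prop) _ _), intervalIntegral.integral_const_mul,
      intervalIntegral.integral_const_mul] at h0
    linarith
  have := discrim_le_zero key
  rw [discrim] at this
  linarith

namespace IsWaveProfile

variable {c b : ℝ} {W : ℝ → ℝ}

/-- A Wronskian identity with the kernel element `W'` controls the value at the origin. -/
theorem sq_apply_zero_le (h : IsWaveProfile c b W) {P : ℝ}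
    (hP : ∀ R, 0 ≤ R → ∫ x in (0 : ℝ)..R, deriv W x ^ 2 ≤ P) {T T' g : ℝ → ℝ}
    (hT : ∀ x, HasDerivAt T (T' x) x)
    (hT' : ∀ x, HasDerivAt T' ((T x - 2 * b * W x * T x - g x) / c) x)
    (hg : Continuous g) (hgi : Integrable fun x => g x ^ 2) (h0 : T' 0 = 0) {R : ℝ} (hR : 0 ≤ R)
    (hTR : T R = 0) (hTR' : T' R = 0) :
    (c * ((W 0 - b * W 0 ^ 2) / c)) ^ 2 * T 0 ^ 2 ≤ (∫ x, g x ^ 2) * P := by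
  have hc := h.c_pos
  have hcW := h.contDiff.continuous
  have hcp := h.continuous_deriv
  -- W' solves the homogeneous linearized equation, so the derivative of c (T W'' - T' W') reduces
  -- to g W'. On [0, R] only the term at 0 survives.
  have hd : ∀ x, HasDerivAt
      (fun x => c * (T x * ((W x - b * W x ^ 2) / c) - T' x * deriv W x)) (g x * deriv W x) x := by
    intro x
    have e2 := ((h.hasDerivAt x).sub (((h.hasDerivAt x).pow 2).const_mul b)).div_const c
    refine ((((hT x).mul e2).sub ((hT' x).mul (h.hasDerivAt_deriv x))).const_mul c).congr_deriv ?_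
    simp only [Pi.sub_apply, Pi.pow_apply, Nat.cast_ofNat, Nat.add_one_sub_one, pow_one]
    field_simp
    ring
  have hFTC := intervalIntegral.integral_eq_sub_of_hasDerivAt (a := 0) (b := R) (fun x _ => hd x)
    (Continuous.intervalIntegrable (by fun_prop) _ _)
  rw [hTR, hTR', h0, zero_mul, zero_mul, zero_mul, sub_zero, mul_zero, zero_sub] at hFTC
  have hcs := sq_intervalIntegral_mul_le hg hcp hR
  rw [hFTC] at hcs
  have hgR : ∫ x in (0 : ℝ)..R, g x ^ 2 ≤ ∫ x, g x ^ 2 := by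
    rw [intervalIntegral.integral_of_le hR]
    exact setIntegral_le_integral hgi (Eventually.of_forall fun x => sq_nonneg _)
  calc (c * ((W 0 - b * W 0 ^ 2) / c)) ^ 2 * T 0 ^ 2
      = (-(c * (T 0 * ((W 0 - b * W 0 ^ 2) / c) - 0))) ^ 2 := by ring
    _ ≤ _ := hcs
    _ ≤ _ := mul_le_mul hgR (hP R hR)
      (intervalIntegral.integral_nonneg hR fun x _ => sq_nonneg _)
      (integral_nonneg fun x => sq_nonneg _)

/-- The KdV linearization `T ↦ T - c T'' - 2 b W T` is bounded below on even functions. -/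
theorem exists_integral_sq_le (h : IsWaveProfile c b W) :
    ∃ C : ℝ, 0 ≤ C ∧ ∀ T : ℝ → ℝ, ContDiff ℝ 2 T → HasCompactSupport T → Function.Even T →
      ∫ x, T x ^ 2 ≤ C * ∫ x, (T x - c * deriv (deriv T) x - 2 * b * W x * T x) ^ 2 := by
  obtain ⟨K, hK, hWK, hpK⟩ := h.exists_bound
  obtain ⟨P, hP0, hP⟩ := h.exists_integral_deriv_sq_le
  have hb := h.b_pos
  have hc := h.c_pos
  have hcW := h.contDiff.continuous
  have hcp := h.continuous_deriv
  -- With W ≤ 1/(8b) outside [-R₀, R₀], the potential 2bW is at most 1/4 there. Together with the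
  -- 1/4 spent on ∫ g T, this leaves half of ∫ T².
  obtain ⟨R₀, hR₀, hWR₀⟩ := h.exists_forall_le (show 0 < 1 / (8 * b) by positivity)
  set w := c * ((W 0 - b * W 0 ^ 2) / c) with hw
  have hw0 : 0 < w ^ 2 := by
    have := mul_ne_zero hc.ne' h.deriv_deriv_zero_ne
    positivity
  set Q := (1 + 2 * b * K) / c with hQdef
  -- The Gronwall factor on [0, R₀], times the bound P/w² for T(0)² and the forcing g/c, both
  -- relative to ∫ g².
  set C₁ := Real.exp ((Q + 2) * R₀) * (P / w ^ 2 + 1 / c ^ 2) with hC₁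
  have hC₁0 : 0 ≤ C₁ := by positivity
  refine ⟨2 * (1 + 2 * b * K * C₁ * (2 * R₀)), by positivity, fun T hT hTs hTe => ?_⟩
  set g : ℝ → ℝ := fun x => T x - c * deriv (deriv T) x - 2 * b * W x * T x with hgdef
  have hT1 : ContDiff ℝ 1 (deriv T) :=
    (contDiff_succ_iff_deriv.1 (show ContDiff ℝ (1 + 1) T from hT)).2.2
  have hdT : ∀ x, HasDerivAt T (deriv T x) x := fun x =>
    (hT.differentiable (by norm_num) x).hasDerivAt
  have hdT' : ∀ x, HasDerivAt (deriv T) (deriv (deriv T) x) x := fun x =>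
    (hT1.differentiable (by norm_num) x).hasDerivAt
  have hcT := hT.continuous
  have hcT1 := hT1.continuous
  have hcT2 : Continuous (deriv (deriv T)) := hT1.continuous_deriv (by norm_num)
  have hg : Continuous g := by fun_prop
  have hgs : HasCompactSupport g :=
    (hTs.sub (hTs.deriv.deriv.mul_left (f := fun _ => c))).sub
      (hTs.mul_left (f := fun x => 2 * b * W x))
  have int_of : ∀ f₁ f₂ : ℝ → ℝ, Continuous f₁ → Continuous f₂ → HasCompactSupport f₂ →
      Integrable fun x => f₁ x * f₂ x := fun f₁ f₂ h₁ h₂ h₃ =>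
    (h₁.mul h₂).integrable_of_hasCompactSupport h₃.mul_left
  have hgi : Integrable fun x => g x ^ 2 := by simpa [sq] using int_of g g hg hg hgs
  have hTi : Integrable fun x => T x ^ 2 := by simpa [sq] using int_of T T hcT hcT hTs
  have hT''eq : ∀ x, deriv (deriv T) x = (T x - 2 * b * W x * T x - g x) / c := by
    intro x
    simp only [hgdef]
    field_simp
    ring
  have hT0 : deriv T 0 = 0 := deriv_zero_of_even hTe
  set H := ∫ x, g x ^ 2 with hH
  have hH0 : 0 ≤ H := integral_nonneg fun x => sq_nonneg _
  -- the value at the origin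
  have hTzero : T 0 ^ 2 ≤ P / w ^ 2 * H := by
    obtain ⟨R, hR⟩ := (hTs.isCompact.union hTs.deriv.isCompact).isBounded.subset_closedBall 0
    have hout : max R 0 + 1 ∉ Metric.closedBall (0 : ℝ) R := by
      rw [Metric.mem_closedBall, Real.dist_eq, sub_zero, not_le]
      exact (le_max_left R 0).trans_lt ((lt_add_one _).trans_le (le_abs_self _))
    have h1 := h.sq_apply_zero_le hP hdT (fun x => hT''eq x ▸ hdT' x) hg hgi hT0
      (R := max R 0 + 1) (by positivity)
      (image_eq_zero_of_notMem_tsupport fun hmem => hout (hR (Or.inl hmem)))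
      (image_eq_zero_of_notMem_tsupport fun hmem => hout (hR (Or.inr hmem)))
    rw [div_mul_eq_mul_div, le_div_iff₀ hw0]
    linarith
  -- growth away from the origin
  have hTnear : ∀ x, 0 ≤ x → x ≤ R₀ → T x ^ 2 ≤ C₁ * H := by
    intro x hx hxR
    have h1 := sq_add_sq_le_exp_mul (g := fun x => g x / c) (Q := Q) hdT hdT' (by fun_prop)
      (by positivity) (fun y => ?_) hx
    · have h2 : ∫ y in (0 : ℝ)..x, (g y / c) ^ 2 ≤ 1 / c ^ 2 * H := by
        have : ∀ y, (g y / c) ^ 2 = 1 / c ^ 2 * g y ^ 2 := fun y => by field_simp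
        simp only [this]
        rw [intervalIntegral.integral_const_mul]
        refine mul_le_mul_of_nonneg_left ?_ (by positivity)
        rw [intervalIntegral.integral_of_le hx]
        exact setIntegral_le_integral hgi (Eventually.of_forall fun x => sq_nonneg _)
      have h3 : Real.exp ((Q + 2) * x) ≤ Real.exp ((Q + 2) * R₀) :=
        Real.exp_le_exp.2 (mul_le_mul_of_nonneg_left hxR (by positivity))
      have h4 : T 0 ^ 2 + deriv T 0 ^ 2 + ∫ y in (0 : ℝ)..x, (g y / c) ^ 2
          ≤ (P / w ^ 2 + 1 / c ^ 2) * H := by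
        rw [hT0]
        linarith
      have h5 : 0 ≤ (P / w ^ 2 + 1 / c ^ 2) * H := by positivity
      calc T x ^ 2 ≤ T x ^ 2 + deriv T x ^ 2 := le_add_of_nonneg_right (sq_nonneg _)
        _ ≤ _ := h1
        _ ≤ Real.exp ((Q + 2) * x) * ((P / w ^ 2 + 1 / c ^ 2) * H) :=
          mul_le_mul_of_nonneg_left h4 (Real.exp_pos _).le
        _ ≤ Real.exp ((Q + 2) * R₀) * ((P / w ^ 2 + 1 / c ^ 2) * H) :=
          mul_le_mul_of_nonneg_right h3 h5
        _ = C₁ * H := by rw [hC₁]; ring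
    · have e : deriv (deriv T) y = (1 - 2 * b * W y) / c * T y - g y / c := by
        rw [hT''eq]
        field_simp
      rw [e]
      refine (abs_sub _ _).trans ?_
      rw [abs_mul, abs_div (1 - 2 * b * W y), abs_of_pos hc]
      gcongr
      rw [hQdef]
      gcongr
      rw [abs_le]
      have k1 := mul_le_mul_of_nonneg_left (hWK y) hb.le
      have k2 := mul_nonneg hb.le (h.nonneg y)
      constructor <;> linarith
  have hTnear' : ∀ x ∈ Icc (-R₀) R₀, T x ^ 2 ≤ C₁ * H := by
    intro x hx
    rcases le_total 0 x with hx0 | hx0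
    · exact hTnear x hx0 hx.2
    · rw [← hTe x]
      exact hTnear _ (by linarith) (by linarith [hx.1])
  -- the energy identity
  have hparts : ∫ x, T x * deriv (deriv T) x = -∫ x, deriv T x * deriv T x :=
    integral_mul_deriv_eq_deriv_mul_of_integrable (fun x _ => hdT x) (fun x _ => hdT' x)
      (int_of _ _ hcT hcT2 hTs.deriv.deriv) (int_of _ _ hcT1 hcT1 hTs.deriv)
      (int_of _ _ hcT hcT1 hTs.deriv)
  have hWT : Integrable fun x => 2 * b * W x * T x ^ 2 := by
    simpa [sq, mul_assoc] using int_of (fun x => 2 * b * W x * T x) T (by fun_prop) hcT hTs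
  have hWTle : ∫ x, 2 * b * W x * T x ^ 2 ≤
      1 / 4 * (∫ x, T x ^ 2) + 2 * b * K * C₁ * H * (2 * R₀) := by
    have hind : Integrable ((Icc (-R₀) R₀).indicator fun _ : ℝ => 2 * b * K * C₁ * H) :=
      (integrable_indicator_iff measurableSet_Icc).2
        (continuous_const.integrableOn_Icc)
    have hle : ∀ x, 2 * b * W x * T x ^ 2 ≤
        1 / 4 * T x ^ 2 + (Icc (-R₀) R₀).indicator (fun _ : ℝ => 2 * b * K * C₁ * H) x := by
      intro x
      by_cases hx : x ∈ Icc (-R₀) R₀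
      · rw [indicator_of_mem hx]
        have k0 := mul_le_mul_of_nonneg_left (hWK x) (show 0 ≤ 2 * b by positivity)
        have k1 := mul_le_mul_of_nonneg_right k0 (sq_nonneg (T x))
        have k2 := mul_le_mul_of_nonneg_left (hTnear' x hx) (show 0 ≤ 2 * b * K by positivity)
        have := sq_nonneg (T x)
        nlinarith
      · rw [indicator_of_notMem hx, add_zero]
        refine mul_le_mul_of_nonneg_right ?_ (sq_nonneg _)
        have hx' : R₀ ≤ |x| := by
          by_contra! hcon
          exact hx (abs_le.1 hcon.le)
        have := mul_le_mul_of_nonneg_left (hWR₀ x hx') (show 0 ≤ 2 * b by positivity)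
        refine this.trans (le_of_eq ?_)
        field_simp
        norm_num
    refine (integral_mono hWT ((hTi.const_mul _).add hind) hle).trans (le_of_eq ?_)
    rw [integral_add' (hTi.const_mul _) hind, integral_const_mul,
      integral_indicator measurableSet_Icc, setIntegral_const, smul_eq_mul]
    have : volume.real (Icc (-R₀) R₀) = 2 * R₀ := by
      rw [Real.volume_real_Icc_of_le (by linarith)]
      ring
    rw [this]
    ring
  have hgT : Integrable fun x => g x * T x := int_of g T hg hcT hTs
  have hgTle : ∫ x, g x * T x ≤ 1 / 4 * (∫ x, T x ^ 2) + H := by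
    rw [hH, ← integral_const_mul, ← integral_add (hTi.const_mul _) hgi]
    refine integral_mono hgT ((hTi.const_mul _).add hgi) fun x => ?_
    simp only
    nlinarith [sq_nonneg (g x - T x / 2)]
  have henergy : ∫ x, g x * T x =
      (∫ x, T x ^ 2) + c * (∫ x, deriv T x ^ 2) - ∫ x, 2 * b * W x * T x ^ 2 := by
    have e : ∀ x, g x * T x = T x ^ 2 - c * (T x * deriv (deriv T) x) - 2 * b * W x * T x ^ 2 := by
      intro x
      simp only [hgdef]
      ring
    have i1 := (int_of _ _ hcT hcT2 hTs.deriv.deriv).const_mul c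
    rw [integral_congr_ae (Eventually.of_forall e), integral_sub (by exact hTi.sub i1) hWT,
      integral_sub hTi i1, integral_const_mul, hparts]
    simp only [sq]
    ring
  have hpos : 0 ≤ c * ∫ x, deriv T x ^ 2 := mul_nonneg hc.le (integral_nonneg fun x => sq_nonneg _)
  change ∫ x, T x ^ 2 ≤ 2 * (1 + 2 * b * K * C₁ * (2 * R₀)) * H
  linarith

end IsWaveProfile

end KdVChain

/-! ### Translations and averages on L² -/

namespace KdVChain

open Set Filter Topology
open scoped ENNReal InnerProductSpace

noncomputable section

/-- The real Hilbert space `L²(ℝ)`. -/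
abbrev L2 := Lp ℝ 2 (volume : Measure ℝ)

/-- The translation `(τ_s V)(x) = V(s + x)`. -/
def translate (s : ℝ) : L2 →ₗᵢ[ℝ] L2 :=
  Lp.compMeasurePreservingₗᵢ ℝ (s + ·) (measurePreserving_add_left volume s)

/-- The reflection `V ↦ V(-·)`. -/
def reflect : L2 →ₗᵢ[ℝ] L2 :=
  Lp.compMeasurePreservingₗᵢ ℝ Neg.neg (Measure.measurePreserving_neg volume)

theorem coeFn_translate (s : ℝ) (V : L2) : translate s V =ᵐ[volume] fun x => V (s + x) :=
  Lp.coeFn_compMeasurePreserving V _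

theorem coeFn_reflect (V : L2) : reflect V =ᵐ[volume] fun x => V (-x) :=
  Lp.coeFn_compMeasurePreserving V _

theorem continuous_translate (V : L2) : Continuous fun s => translate s V :=
  Continuous.compMeasurePreservingLp (f := fun _ => V)
    (g := fun s => (⟨(s + ·), by fun_prop⟩ : C(ℝ, ℝ))) continuous_const
    ((ContinuousMap.mk (fun a : ℝ × ℝ => a.1 + a.2) continuous_add).curry.continuous)
    (fun s => measurePreserving_add_left volume s) (by simp)

theorem translate_translate (s t : ℝ) (V : L2) :
    translate s (translate t V) = translate (s + t) V := by
  refine (Lp.compMeasurePreserving_comp_apply (g := V) (measurePreserving_add_left volume t)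
    (measurePreserving_add_left volume s)).symm.trans ?_
  have : ((t + ·) ∘ (s + ·) : ℝ → ℝ) = (s + t + ·) := by
    ext x
    simp only [Function.comp_apply]
    ring
  simp only [translate, ← this]
  rfl

theorem translate_zero (V : L2) : translate 0 V = V := by
  refine Lp.ext ((coeFn_translate 0 V).trans (Eventually.of_forall fun x => ?_))
  simp

theorem inner_translate_left (s : ℝ) (U V : L2) :
    ⟪translate s U, V⟫_ℝ = ⟪U, translate (-s) V⟫_ℝ := by
  rw [← (translate s).inner_map_map U, translate_translate, add_neg_cancel, translate_zero]

theorem reflect_translate (s : ℝ) (V : L2) :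
    reflect (translate s V) = translate (-s) (reflect V) := by
  refine (Lp.compMeasurePreserving_comp_apply (g := V) (measurePreserving_add_left volume s)
    (Measure.measurePreserving_neg volume)).symm.trans
    (Eq.trans ?_ (Lp.compMeasurePreserving_comp_apply (g := V)
      (Measure.measurePreserving_neg volume) (measurePreserving_add_left volume (-s))))
  have : ((s + ·) ∘ Neg.neg : ℝ → ℝ) = Neg.neg ∘ (-s + ·) := by
    ext x
    simp only [Function.comp_apply]
    ring
  simp only [this]

theorem mem_evenL2_iff (V : L2) : V ∈ evenL2 ↔ reflect V = V := by
  rw [Lp.ext_iff]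
  constructor
  · intro h
    exact (coeFn_reflect V).trans h
  · intro h
    exact (coeFn_reflect V).symm.trans h

theorem norm_translate_mul_sub_le (n : ℕ) (r : ℝ) (V : L2) :
    ‖translate (n * r) V - V‖ ≤ n * ‖translate r V - V‖ := by
  induction n with
  | zero => simp [translate_zero]
  | succ n ih =>
    have e : translate ((n + 1 : ℕ) * r) V - V =
        translate r (translate (n * r) V - V) + (translate r V - V) := by
      rw [map_sub, translate_translate, sub_add_sub_cancel]
      congr 3
      push_cast
      ring
    rw [e]
    refine (norm_add_le _ _).trans ?_
    rw [LinearIsometry.norm_map]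
    push_cast
    linarith

theorem norm_translate_neg_sub (r : ℝ) (V : L2) :
    ‖translate (-r) V - V‖ = ‖translate r V - V‖ := by
  rw [← (translate r).norm_map (translate (-r) V - V), map_sub, translate_translate,
    add_neg_cancel, translate_zero, norm_sub_rev]

/-- The average of translates of `V` against a kernel `k`. -/
def kernelAvg (k : ℝ → ℝ) (a b : ℝ) (V : L2) : L2 := ∫ s in a..b, k s • translate s V

theorem memLp_comp_add (V : L2) (a b : ℝ) :
    MemLp (fun z : ℝ × ℝ => V (z.1 + z.2)) 2 ((volume.restrict (Ioc a b)).prod volume) :=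
  ((Lp.memLp V).comp_snd (volume.restrict (Ioc a b))).comp_measurePreserving
    (measurePreserving_prod_add (volume.restrict (Ioc a b)) volume)

/-- Links the Bochner integral in L² to the pointwise integral: the two have equal integrals over
every set of finite measure, by pairing with the indicator and Fubini. -/
theorem coeFn_kernelAvg {k : ℝ → ℝ} (hk : Continuous k) {a b : ℝ} (hab : a ≤ b) (V : L2) :
    kernelAvg k a b V =ᵐ[volume] fun x => ∫ s in a..b, k s * V (s + x) := by
  have hprod : ∀ A : Set ℝ, volume A < ∞ → Integrable (fun z : ℝ × ℝ => k z.1 * V (z.1 + z.2))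
      ((volume.restrict (Ioc a b)).prod (volume.restrict A)) := by
    intro A hA
    have : IsFiniteMeasure (volume.restrict A) := isFiniteMeasure_restrict.2 hA.ne
    have h1 : MemLp (fun z : ℝ × ℝ => V (z.1 + z.2)) 2
        ((volume.restrict (Ioc a b)).prod (volume.restrict A)) :=
      (memLp_comp_add V a b).mono_measure (Measure.prod_mono le_rfl Measure.restrict_le_self)
    have h2 : MemLp k 2 (volume.restrict (Ioc a b)) :=
      (memLp_two_iff_integrable_sq hk.aestronglyMeasurable).2 (hk.pow 2).integrableOn_Ioc
    exact (h2.comp_fst (volume.restrict A)).integrable_mul h1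
  refine ae_eq_of_forall_setIntegral_eq_of_sigmaFinite (fun A _ hA => ?_) (fun A _ hA => ?_)
    (fun A hAm hA => ?_)
  · have : IsFiniteMeasure (volume.restrict A) := isFiniteMeasure_restrict.2 hA.ne
    exact ((Lp.memLp _).mono_measure Measure.restrict_le_self).integrable (by norm_num)
  · have := (hprod A hA).integral_prod_right
    simp only [intervalIntegral.integral_of_le hab]
    exact this
  · have hint : IntervalIntegrable (fun s => k s • translate s V) volume a b :=
      (hk.smul (continuous_translate V)).intervalIntegrable _ _
    rw [← L2.inner_indicatorConstLp_one (𝕜 := ℝ) hAm hA.ne]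
    have h1 := (innerSL ℝ (indicatorConstLp 2 hAm hA.ne (1 : ℝ))).intervalIntegral_comp_comm hint
    simp only [innerSL_apply_apply] at h1
    rw [kernelAvg, ← h1]
    simp only [intervalIntegral.integral_of_le hab]
    rw [← integral_integral_swap (hprod A hA)]
    refine integral_congr_ae (Eventually.of_forall fun s => ?_)
    simp only
    rw [inner_smul_right, L2.inner_indicatorConstLp_one (𝕜 := ℝ) hAm hA.ne,
      integral_const_mul]
    congr 1
    exact integral_congr_ae (ae_restrict_of_ae (coeFn_translate s V))

theorem norm_kernelAvg_sub_le {k : ℝ → ℝ} (hk : Continuous k) {a b : ℝ} (hab : a ≤ b)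
    (hk0 : ∀ s ∈ Icc a b, 0 ≤ k s) {V U : L2} {δ : ℝ}
    (hδ : ∀ s ∈ Icc a b, ‖translate s V - U‖ ≤ δ) :
    ‖kernelAvg k a b V - (∫ s in a..b, k s) • U‖ ≤ (∫ s in a..b, k s) * δ := by
  have h1 : Continuous fun s => k s • translate s V := hk.smul (continuous_translate V)
  have h2 : Continuous fun s => k s • U := hk.smul continuous_const
  rw [kernelAvg, ← intervalIntegral.integral_smul_const, ← intervalIntegral.integral_sub
    (h1.intervalIntegrable _ _) (h2.intervalIntegrable _ _), ← intervalIntegral.integral_mul_const]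
  refine intervalIntegral.norm_integral_le_of_norm_le hab (Eventually.of_forall fun s hs => ?_)
    ((hk.mul continuous_const).intervalIntegrable _ _)
  have hs' : s ∈ Icc a b := Ioc_subset_Icc_self hs
  rw [← smul_sub, norm_smul, Real.norm_of_nonneg (hk0 s hs')]
  exact mul_le_mul_of_nonneg_left (hδ s hs') (hk0 s hs')

/-- The averaging operator on `L²(ℝ)`. -/
def avg (η : ℝ) : L2 →L[ℝ] L2 :=
  LinearMap.mkContinuous
    { toFun := fun V => η⁻¹ • kernelAvg (fun _ => 1) (-(η / 2)) (η / 2) V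
      map_add' := fun U V => by
        simp only [kernelAvg, one_smul, map_add]
        rw [intervalIntegral.integral_add ((continuous_translate U).intervalIntegrable _ _)
          ((continuous_translate V).intervalIntegrable _ _), smul_add]
      map_smul' := fun c V => by
        simp only [kernelAvg, one_smul, map_smul, RingHom.id_apply]
        rw [intervalIntegral.integral_smul, smul_comm] } 1 (by
    intro V
    change ‖η⁻¹ • kernelAvg (fun _ => 1) (-(η / 2)) (η / 2) V‖ ≤ 1 * ‖V‖
    rw [norm_smul, kernelAvg]
    have h := intervalIntegral.norm_integral_le_of_norm_le_const (a := -(η / 2)) (b := η / 2)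
      (f := fun s => (1 : ℝ) • translate s V) (C := ‖V‖) (fun s _ => by simp)
    rw [show η / 2 - -(η / 2) = η by ring] at h
    refine (mul_le_mul_of_nonneg_left h (norm_nonneg _)).trans ?_
    rw [norm_inv, Real.norm_eq_abs, mul_left_comm, one_mul]
    -- This also covers η = 0, where the inverse is 0, so the operator is defined for every real η.
    exact mul_le_of_le_one_right (norm_nonneg _) inv_mul_le_one)

theorem avg_apply (η : ℝ) (V : L2) :
    avg η V = η⁻¹ • ∫ s in (-(η / 2))..(η / 2), translate s V := by
  simp only [avg, kernelAvg, LinearMap.mkContinuous_apply, LinearMap.coe_mk, AddHom.coe_mk,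
    one_smul]

theorem norm_avg_le (η : ℝ) (V : L2) : ‖avg η V‖ ≤ ‖V‖ := by
  simpa using (avg η).le_of_opNorm_le (LinearMap.mkContinuous_norm_le _ zero_le_one _) V

theorem opA_eq_integral_translate (η : ℝ) (f : ℝ → ℝ) (x : ℝ) :
    opA η f x = η⁻¹ * ∫ s in (-(η / 2))..(η / 2), f (s + x) := by
  rw [opA, intervalIntegral.integral_comp_add_right, one_div]
  congr 2 <;> ring

theorem opA_congr {f g : ℝ → ℝ} (h : f =ᵐ[volume] g) (η : ℝ) : opA η f = opA η g := by
  ext x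
  rw [opA, opA]
  congr 1
  exact intervalIntegral.integral_congr_ae (h.mono fun _ hx _ => hx)

theorem coeFn_avg {η : ℝ} (hη : 0 < η) (V : L2) : avg η V =ᵐ[volume] opA η V := by
  have h1 := coeFn_kernelAvg (k := fun _ => 1) continuous_const
    (show -(η / 2) ≤ η / 2 by linarith) V
  have h2 := Lp.coeFn_smul η⁻¹ (kernelAvg (fun _ => 1) (-(η / 2)) (η / 2) V)
  filter_upwards [h1, h2] with x hx1 hx2
  rw [opA_eq_integral_translate]
  refine hx2.trans ?_
  rw [Pi.smul_apply, hx1]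
  simp

/-- The adjoint of translation by s is translation by -s, and the averaging window is symmetric. -/
theorem inner_avg_left (η : ℝ) (U V : L2) : ⟪avg η U, V⟫_ℝ = ⟪U, avg η V⟫_ℝ := by
  rw [avg_apply, avg_apply, real_inner_smul_left, real_inner_smul_right]
  congr 1
  have h1 := (innerSL ℝ V).intervalIntegral_comp_comm
    ((continuous_translate U).intervalIntegrable (μ := volume) (-(η / 2)) (η / 2))
  have h2 := (innerSL ℝ U).intervalIntegral_comp_comm
    ((continuous_translate V).intervalIntegrable (μ := volume) (-(η / 2)) (η / 2))
  simp only [innerSL_apply_apply] at h1 h2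
  rw [real_inner_comm, ← h1, ← h2]
  simp only [real_inner_comm _ V, inner_translate_left]
  rw [intervalIntegral.integral_comp_neg (f := fun s => ⟪U, translate s V⟫_ℝ), neg_neg]

theorem reflect_avg (η : ℝ) (V : L2) : reflect (avg η V) = avg η (reflect V) := by
  rw [avg_apply, avg_apply, map_smul]
  congr 1
  have h1 := reflect.toContinuousLinearMap.intervalIntegral_comp_comm
    ((continuous_translate V).intervalIntegrable (μ := volume) (-(η / 2)) (η / 2))
  simp only [LinearIsometry.coe_toContinuousLinearMap] at h1
  rw [← h1]
  simp only [reflect_translate]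
  rw [intervalIntegral.integral_comp_neg (f := fun s => translate s (reflect V)), neg_neg]

theorem norm_avg_sub_le {η : ℝ} (hη : 0 < η) {V U : L2} {δ : ℝ}
    (hδ : ∀ s, |s| ≤ η / 2 → ‖translate s V - U‖ ≤ δ) : ‖avg η V - U‖ ≤ δ := by
  have h := norm_kernelAvg_sub_le (k := fun _ => 1) continuous_const
    (show -(η / 2) ≤ η / 2 by linarith) (fun _ _ => zero_le_one) (fun s hs => hδ s (abs_le.2 hs))
  simp only [intervalIntegral.integral_const, smul_eq_mul, mul_one,
    show η / 2 - -(η / 2) = η by ring] at h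
  have e : avg η V - U = η⁻¹ • (kernelAvg (fun _ => 1) (-(η / 2)) (η / 2) V - η • U) := by
    rw [smul_sub, inv_smul_smul₀ hη.ne']
    rfl
  rw [e, norm_smul, norm_inv, Real.norm_of_nonneg hη.le]
  rwa [inv_mul_le_iff₀ hη]

/-- The variance identity for averages. -/
theorem integral_norm_translate_sub_avg_sq {η : ℝ} (hη : 0 < η) (V : L2) :
    ∫ s in (-(η / 2))..(η / 2), ‖translate s V - avg η V‖ ^ 2 =
      η * (‖V‖ ^ 2 - ‖avg η V‖ ^ 2) := by
  have hc := continuous_translate V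
  have e : ∀ s, ‖translate s V - avg η V‖ ^ 2 =
      (‖V‖ ^ 2 + ‖avg η V‖ ^ 2) - 2 * ⟪avg η V, translate s V⟫_ℝ := by
    intro s
    rw [norm_sub_sq_real, LinearIsometry.norm_map, real_inner_comm]
    ring
  have h1 := (innerSL ℝ (avg η V)).intervalIntegral_comp_comm
    (hc.intervalIntegrable (μ := volume) (-(η / 2)) (η / 2))
  simp only [innerSL_apply_apply] at h1
  have h2 : ∫ s in (-(η / 2))..(η / 2), translate s V = η • avg η V := by
    rw [avg_apply, smul_inv_smul₀ hη.ne']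
  have hci : Continuous fun s => ⟪avg η V, translate s V⟫_ℝ := continuous_const.inner hc
  simp only [e]
  rw [intervalIntegral.integral_sub (by simp)
    ((hci.const_mul 2).intervalIntegrable _ _), intervalIntegral.integral_const_mul, h1, h2,
    real_inner_smul_right, real_inner_self_eq_norm_sq]
  simp only [intervalIntegral.integral_const, smul_eq_mul]
  ring

/-- Up to a common translation, V and its r-translate are two translates within the averaging
window. Each is compared with the mean and the base point t is averaged, so the variance identity
applies. -/
theorem norm_translate_sub_sq_le {η r : ℝ} (hη : 0 < η) (hr : |r| ≤ η / 2) (V : L2) :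
    ‖translate r V - V‖ ^ 2 ≤ 8 * (‖V‖ ^ 2 - ‖avg η V‖ ^ 2) := by
  wlog hr0 : 0 ≤ r generalizing r
  · rw [← norm_translate_neg_sub]
    exact this (by rwa [abs_neg]) (by linarith)
  rw [abs_of_nonneg hr0] at hr
  set e : ℝ → ℝ := fun s => ‖translate s V - avg η V‖ ^ 2 with he
  have hce : Continuous e := ((continuous_translate V).sub continuous_const).norm.pow 2
  have he0 : ∀ s, 0 ≤ e s := fun s => sq_nonneg _
  have hvar := integral_norm_translate_sub_avg_sq hη V
  have hsub : ∀ a b : ℝ, -(η / 2) ≤ a → a ≤ b → b ≤ η / 2 →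
      ∫ s in a..b, e s ≤ η * (‖V‖ ^ 2 - ‖avg η V‖ ^ 2) := by
    intro a b h1 h2 h3
    rw [← hvar]
    exact intervalIntegral.integral_mono_interval h1 h2 h3 (Eventually.of_forall he0)
      (hce.intervalIntegrable _ _)
  have hpt : ∀ t, ‖translate r V - V‖ ^ 2 ≤ 2 * e (t + r) + 2 * e t := by
    intro t
    have h1 : ‖translate r V - V‖ = ‖(translate (t + r) V - avg η V)
        - (translate t V - avg η V)‖ := by
      rw [sub_sub_sub_cancel_right, ← translate_translate t r, ← map_sub,
        LinearIsometry.norm_map]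
    have h2 := norm_sub_le (translate (t + r) V - avg η V) (translate t V - avg η V)
    rw [← h1] at h2
    have h3 := pow_le_pow_left₀ (norm_nonneg _) h2 2
    simp only [he]
    nlinarith [sq_nonneg (‖translate (t + r) V - avg η V‖ - ‖translate t V - avg η V‖)]
  -- For t in [-η/2, 0], both t and t + r stay in the window. The two integrals give at most 4η
  -- times the defect; dividing by the length η/2 yields 8.
  have hint : ∫ t in (-(η / 2))..0, ‖translate r V - V‖ ^ 2 ≤
      ∫ t in (-(η / 2))..0, (2 * e (t + r) + 2 * e t) :=
    intervalIntegral.integral_mono (by linarith) (by simp)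
      (Continuous.intervalIntegrable (by fun_prop) _ _) hpt
  rw [intervalIntegral.integral_add (Continuous.intervalIntegrable (by fun_prop) _ _)
    (Continuous.intervalIntegrable (by fun_prop) _ _), intervalIntegral.integral_const_mul,
    intervalIntegral.integral_const_mul, intervalIntegral.integral_comp_add_right,
    intervalIntegral.integral_const, smul_eq_mul] at hint
  have h1 := hsub (-(η / 2) + r) (0 + r) (by linarith) (by linarith) (by linarith)
  have h2 := hsub (-(η / 2)) 0 le_rfl (by linarith) (by linarith)
  refine le_of_mul_le_mul_left ?_ (show 0 < η / 2 by linarith)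
  linarith

/-- Smallness of translations of length up to `M η` from the energy at scale `η`. -/
theorem norm_translate_sub_le {η : ℝ} (hη : 0 < η) {M : ℕ} (hM : 1 ≤ M) {s : ℝ} (hs : |s| ≤ M * η)
    {V : L2} {q : ℝ} (hq0 : 0 ≤ q) (hq : ‖V‖ ^ 2 - ‖avg η V‖ ^ 2 ≤ q ^ 2) :
    ‖translate s V - V‖ ≤ 6 * M * q := by
  have hM0 : (0 : ℝ) < M := by exact_mod_cast hM
  -- Splitting s into 2M equal steps makes each at most η/2. One step costs at most 3q since √8 ≤ 3,
  -- hence 6Mq in total.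
  set r := s / (2 * M) with hr
  have hrs : ((2 * M : ℕ) : ℝ) * r = s := by
    rw [hr]
    push_cast
    field_simp
  have hrη : |r| ≤ η / 2 := by
    rw [hr, abs_div, abs_of_pos (by positivity : (0 : ℝ) < 2 * M), div_le_iff₀ (by positivity)]
    linarith
  have h1 := norm_translate_sub_sq_le hη hrη V
  have h2 : ‖translate r V - V‖ ≤ 3 * q := by
    refine abs_le_of_sq_le_sq' ?_ (by positivity) |>.2
    nlinarith
  have h3 := norm_translate_mul_sub_le (2 * M) r V
  rw [hrs] at h3
  refine h3.trans ?_
  push_cast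
  nlinarith

end

end KdVChain

/-! ### Multiplication operators, `L_ε` as a symmetric bounded operator, even approximation -/

namespace KdVChain

open Set Filter Topology
open scoped ENNReal InnerProductSpace BoundedContinuousFunction

noncomputable section

theorem norm_bcf_mul_le (w : ℝ →ᵇ ℝ) (V : ℝ → ℝ) (x : ℝ) : ‖w x * V x‖ ≤ ‖w‖ * ‖V x‖ :=
  (norm_mul _ _).trans_le (mul_le_mul_of_nonneg_right (w.norm_coe_le_norm x) (norm_nonneg _))

theorem memLp_bcf_mul (w : ℝ →ᵇ ℝ) (V : L2) : MemLp (fun x => w x * V x) 2 volume :=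
  (Lp.memLp V).of_le_mul (w.continuous.aestronglyMeasurable.mul (Lp.aestronglyMeasurable V))
    (Eventually.of_forall (norm_bcf_mul_le w V))

/-- Multiplication by a bounded continuous function on `L²(ℝ)`. -/
def mulOp (w : ℝ →ᵇ ℝ) : L2 →L[ℝ] L2 :=
  LinearMap.mkContinuous
    { toFun := fun V => (memLp_bcf_mul w V).toLp _
      map_add' := fun U V => by
        rw [← MemLp.toLp_add, MemLp.toLp_eq_toLp_iff]
        filter_upwards [Lp.coeFn_add U V] with x hx
        rw [hx, Pi.add_apply, Pi.add_apply, mul_add]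
      map_smul' := fun c V => by
        rw [RingHom.id_apply, ← MemLp.toLp_const_smul, MemLp.toLp_eq_toLp_iff]
        filter_upwards [Lp.coeFn_smul c V] with x hx
        rw [hx, Pi.smul_apply, Pi.smul_apply, smul_eq_mul, smul_eq_mul, mul_left_comm] } ‖w‖ (by
    intro V
    refine Lp.norm_le_mul_norm_of_ae_le_mul ?_
    filter_upwards [(memLp_bcf_mul w V).coeFn_toLp] with x hx
    exact (congrArg norm hx).trans_le (norm_bcf_mul_le w V x))

theorem coeFn_mulOp (w : ℝ →ᵇ ℝ) (V : L2) : mulOp w V =ᵐ[volume] fun x => w x * V x :=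
  (memLp_bcf_mul w V).coeFn_toLp

theorem norm_mulOp_le (w : ℝ →ᵇ ℝ) (V : L2) : ‖mulOp w V‖ ≤ ‖w‖ * ‖V‖ :=
  (mulOp w).le_of_opNorm_le (LinearMap.mkContinuous_norm_le _ (norm_nonneg _) _) V

theorem inner_mulOp_left (w : ℝ →ᵇ ℝ) (U V : L2) : ⟪mulOp w U, V⟫_ℝ = ⟪U, mulOp w V⟫_ℝ := by
  rw [L2.inner_def, L2.inner_def]
  refine integral_congr_ae ?_
  filter_upwards [coeFn_mulOp w U, coeFn_mulOp w V] with x h1 h2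
  rw [h1, h2]
  simp only [RCLike.inner_apply, conj_trivial]
  ring

theorem reflect_mulOp {w : ℝ →ᵇ ℝ} (hw : Function.Even w) (V : L2) :
    reflect (mulOp w V) = mulOp w (reflect V) := by
  refine Lp.ext ?_
  have h1 := (Measure.measurePreserving_neg (volume : Measure ℝ)).quasiMeasurePreserving.ae
    (coeFn_mulOp w V)
  filter_upwards [coeFn_reflect (mulOp w V), coeFn_mulOp w (reflect V), coeFn_reflect V, h1]
    with x e1 e2 e3 e4
  rw [e1, e2, e3, e4, hw x]

theorem norm_mulOp_sub_mulOp_le {w w' : ℝ →ᵇ ℝ} {δ : ℝ} (h : ∀ x, |w x - w' x| ≤ δ) (V : L2) :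
    ‖mulOp w V - mulOp w' V‖ ≤ δ * ‖V‖ := by
  refine Lp.norm_le_mul_norm_of_ae_le_mul ?_
  filter_upwards [Lp.coeFn_sub (mulOp w V) (mulOp w' V), coeFn_mulOp w V, coeFn_mulOp w' V]
    with x e1 e2 e3
  rw [e1, Pi.sub_apply, e2, e3, ← sub_mul, norm_mul]
  exact mul_le_mul_of_nonneg_right (h x) (norm_nonneg _)

/-- A discrete product rule: the Lipschitz bound pays for moving w, the sup norm of w for moving V.
-/
theorem norm_translate_mulOp_sub_le {w : ℝ →ᵇ ℝ} {K : ℝ}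
    (hK : ∀ x y, |w x - w y| ≤ K * |x - y|) (s : ℝ) (V : L2) :
    ‖translate s (mulOp w V) - mulOp w V‖ ≤ K * |s| * ‖V‖ + ‖w‖ * ‖translate s V - V‖ := by
  have h1 : ‖translate s (mulOp w V) - mulOp w (translate s V)‖ ≤ K * |s| * ‖translate s V‖ := by
    refine Lp.norm_le_mul_norm_of_ae_le_mul ?_
    have h := (measurePreserving_add_left volume s).quasiMeasurePreserving.ae (coeFn_mulOp w V)
    filter_upwards [Lp.coeFn_sub (translate s (mulOp w V)) (mulOp w (translate s V)),
      coeFn_translate s (mulOp w V), coeFn_mulOp w (translate s V), coeFn_translate s V, h]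
      with x e1 e2 e3 e4 e5
    rw [e1, Pi.sub_apply, e2, e3, e4, e5, ← sub_mul, norm_mul]
    refine mul_le_mul_of_nonneg_right ?_ (norm_nonneg _)
    simpa using hK (s + x) x
  have h2 := norm_mulOp_le w (translate s V - V)
  rw [map_sub] at h2
  rw [LinearIsometry.norm_map] at h1
  calc ‖translate s (mulOp w V) - mulOp w V‖
      = ‖(translate s (mulOp w V) - mulOp w (translate s V)) +
          (mulOp w (translate s V) - mulOp w V)‖ := by rw [sub_add_sub_cancel]
    _ ≤ _ := (norm_add_le _ _).trans (add_le_add h1 h2)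

theorem opA_eq_of_hasDerivAt {F f : ℝ → ℝ} (hF : ∀ x, HasDerivAt F (f x) x) (hf : Continuous f)
    (η x : ℝ) : opA η f x = (F (x + η / 2) - F (x - η / 2)) / η := by
  rw [opA, intervalIntegral.integral_eq_sub_of_hasDerivAt (fun y _ => hF y)
    (hf.intervalIntegrable _ _)]
  ring

theorem hasDerivAt_integral {f : ℝ → ℝ} (hf : Continuous f) (x : ℝ) :
    HasDerivAt (fun x => ∫ y in (0 : ℝ)..x, f y) (f x) x :=
  intervalIntegral.integral_hasDerivAt_right (hf.intervalIntegrable _ _)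
    (hf.stronglyMeasurableAtFilter _ _) hf.continuousAt

theorem continuous_opA {f : ℝ → ℝ} (hf : Continuous f) (η : ℝ) : Continuous (opA η f) := by
  have hF : Continuous fun x => ∫ y in (0 : ℝ)..x, f y :=
    continuous_iff_continuousAt.2 fun x => (hasDerivAt_integral hf x).continuousAt
  rw [show opA η f = _ from funext (opA_eq_of_hasDerivAt (hasDerivAt_integral hf) hf η)]
  exact ((hF.comp (continuous_add_const _)).sub (hF.comp (continuous_sub_right _))).div_const _

theorem abs_opA_sub_le {f : ℝ → ℝ} (hf : Continuous f) {η x y δ : ℝ} (hη : 0 < η)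
    (h : ∀ s, |s| ≤ η / 2 → |f (s + x) - y| ≤ δ) : |opA η f x - y| ≤ δ := by
  have h1 : opA η f x - y = η⁻¹ * ∫ s in (-(η / 2))..(η / 2), (f (s + x) - y) := by
    rw [opA_eq_integral_translate, intervalIntegral.integral_sub
      (Continuous.intervalIntegrable (by fun_prop) _ _) (by simp),
      intervalIntegral.integral_const, smul_eq_mul]
    field_simp
    ring
  have h2 := intervalIntegral.norm_integral_le_of_norm_le_const (a := -(η / 2)) (b := η / 2)
    (f := fun s => f (s + x) - y) (C := δ) (fun s hs => h s (by
      rw [uIoc_of_le (by linarith)] at hs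
      exact abs_le.2 ⟨hs.1.le, hs.2⟩))
  rw [show η / 2 - -(η / 2) = η by ring, abs_of_pos hη, Real.norm_eq_abs] at h2
  rw [h1, abs_mul, abs_inv, abs_of_pos hη, inv_mul_le_iff₀ hη]
  linarith

theorem even_opA {f : ℝ → ℝ} (hf : Function.Even f) (η : ℝ) : Function.Even (opA η f) := by
  intro x
  rw [opA_eq_integral_translate, opA_eq_integral_translate]
  congr 1
  have h := intervalIntegral.integral_comp_neg (a := -(η / 2)) (b := η / 2)
    (fun s => f (s + x))
  rw [neg_neg] at h
  rw [← h]
  refine intervalIntegral.integral_congr fun s _ => ?_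
  rw [← hf]
  congr 1
  ring

/-- The average of a bounded continuous function. -/
def avgBCF (η : ℝ) (w : ℝ →ᵇ ℝ) : ℝ →ᵇ ℝ :=
  BoundedContinuousFunction.ofNormedAddCommGroup (opA η w) (continuous_opA w.continuous η) ‖w‖ (by
    intro x
    rw [opA_eq_integral_translate, Real.norm_eq_abs, abs_mul]
    have h := intervalIntegral.norm_integral_le_of_norm_le_const (a := -(η / 2)) (b := η / 2)
      (f := fun s => w (s + x)) (C := ‖w‖) (fun s _ => w.norm_coe_le_norm _)
    rw [show η / 2 - -(η / 2) = η by ring, Real.norm_eq_abs] at h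
    refine (mul_le_mul_of_nonneg_left h (abs_nonneg _)).trans ?_
    rw [abs_inv, mul_left_comm]
    exact mul_le_of_le_one_right (norm_nonneg _) inv_mul_le_one)

@[simp]
theorem coe_avgBCF (η : ℝ) (w : ℝ →ᵇ ℝ) : ⇑(avgBCF η w) = opA η w := rfl

theorem norm_avgBCF_le (η : ℝ) (w : ℝ →ᵇ ℝ) : ‖avgBCF η w‖ ≤ ‖w‖ :=
  BoundedContinuousFunction.norm_ofNormedAddCommGroup_le _ (norm_nonneg _) _

theorem coeFn_sum {ι : Type*} (s : Finset ι) (f : ι → L2) :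
    ((∑ i ∈ s, f i : L2) : ℝ → ℝ) =ᵐ[volume] fun x => ∑ i ∈ s, f i x := by
  classical
  induction s using Finset.induction_on with
  | empty =>
    simp only [Finset.sum_empty]
    exact Lp.coeFn_zero _ _ _
  | insert a s ha ih =>
    rw [Finset.sum_insert ha]
    filter_upwards [Lp.coeFn_add (f a) (∑ i ∈ s, f i), ih] with x h1 h2
    rw [h1, Pi.add_apply, h2, Finset.sum_insert ha]

/-- The operator `B_ε` on `L²(ℝ)`. -/
def clmB (M : ℕ) (α : ℕ → ℝ) (ε : ℝ) : L2 →L[ℝ] L2 :=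
  ContinuousLinearMap.id ℝ L2 + ∑ m ∈ Finset.Icc 1 M, (α m * (m : ℝ) ^ 2 / ε ^ 2) •
    (ContinuousLinearMap.id ℝ L2 - (avg (m * ε)).comp (avg (m * ε)))

/-- The operator `M_ε` on `L²(ℝ)`. -/
def clmM (M : ℕ) (β : ℕ → ℝ) (w : ℝ →ᵇ ℝ) (ε : ℝ) : L2 →L[ℝ] L2 :=
  ∑ m ∈ Finset.Icc 1 M, (2 * (β m * (m : ℝ) ^ 3)) •
    (avg (m * ε)).comp ((mulOp (avgBCF (m * ε) w)).comp (avg (m * ε)))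

/-- The operator `L_ε` on `L²(ℝ)`. -/
def clmL (M : ℕ) (α β : ℕ → ℝ) (w : ℝ →ᵇ ℝ) (ε : ℝ) : L2 →L[ℝ] L2 :=
  clmB M α ε - clmM M β w ε

section

variable (M : ℕ) (α β : ℕ → ℝ) (w : ℝ →ᵇ ℝ) (ε : ℝ)

theorem clmB_apply (V : L2) : clmB M α ε V = V + ∑ m ∈ Finset.Icc 1 M,
    (α m * (m : ℝ) ^ 2 / ε ^ 2) • (V - avg (m * ε) (avg (m * ε) V)) := by
  simp [clmB]

theorem clmM_apply (V : L2) : clmM M β w ε V = ∑ m ∈ Finset.Icc 1 M,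
    (2 * (β m * (m : ℝ) ^ 3)) • avg (m * ε) (mulOp (avgBCF (m * ε) w) (avg (m * ε) V)) := by
  simp [clmM]

variable {ε}

theorem mul_pos_of_mem_Icc {m : ℕ} (hε : 0 < ε) (hm : m ∈ Finset.Icc 1 M) : 0 < (m : ℝ) * ε :=
  mul_pos (by exact_mod_cast (Finset.mem_Icc.1 hm).1) hε

theorem coeFn_clmB (hε : 0 < ε) (V : L2) : clmB M α ε V =ᵐ[volume] opB M α ε V := by
  have hterm : ∀ᵐ x, ∀ m ∈ Finset.Icc 1 M,
      ((α m * (m : ℝ) ^ 2 / ε ^ 2) • (V - avg (m * ε) (avg (m * ε) V)) : L2) x =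
        α m * (m : ℝ) ^ 2 * ((V x - opA (m * ε) (opA (m * ε) V) x) / ε ^ 2) := by
    rw [Filter.eventually_all_finset]
    intro m hm
    have hη := mul_pos_of_mem_Icc M hε hm
    filter_upwards [Lp.coeFn_smul (α m * (m : ℝ) ^ 2 / ε ^ 2) (V - avg (m * ε) (avg (m * ε) V)),
      Lp.coeFn_sub V (avg (m * ε) (avg (m * ε) V)), coeFn_avg hη (avg (m * ε) V)] with x e1 e2 e3
    rw [e1, Pi.smul_apply, e2, Pi.sub_apply, e3, opA_congr (coeFn_avg hη V), smul_eq_mul]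
    ring
  rw [clmB_apply]
  filter_upwards [hterm, Lp.coeFn_add V (∑ m ∈ Finset.Icc 1 M,
    (α m * (m : ℝ) ^ 2 / ε ^ 2) • (V - avg (m * ε) (avg (m * ε) V))), coeFn_sum (Finset.Icc 1 M)
    (fun m => (α m * (m : ℝ) ^ 2 / ε ^ 2) • (V - avg (m * ε) (avg (m * ε) V)))] with x e1 e2 e3
  rw [e2, Pi.add_apply, e3, opB, Finset.sum_congr rfl e1]

theorem coeFn_clmM (hε : 0 < ε) (V : L2) : clmM M β w ε V =ᵐ[volume] opM M β w ε V := by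
  have hterm : ∀ᵐ x, ∀ m ∈ Finset.Icc 1 M,
      ((2 * (β m * (m : ℝ) ^ 3)) •
        avg (m * ε) (mulOp (avgBCF (m * ε) w) (avg (m * ε) V)) : L2) x =
      2 * (β m * (m : ℝ) ^ 3 *
        opA (m * ε) (fun y => opA (m * ε) w y * opA (m * ε) V y) x) := by
    rw [Filter.eventually_all_finset]
    intro m hm
    have hη := mul_pos_of_mem_Icc M hε hm
    have hin : mulOp (avgBCF (m * ε) w) (avg (m * ε) V) =ᵐ[volume]
        fun y => opA (m * ε) w y * opA (m * ε) V y := by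
      filter_upwards [coeFn_mulOp (avgBCF (m * ε) w) (avg (m * ε) V), coeFn_avg hη V] with y e1 e2
      rw [e1, e2, coe_avgBCF]
    filter_upwards [Lp.coeFn_smul (2 * (β m * (m : ℝ) ^ 3))
      (avg (m * ε) (mulOp (avgBCF (m * ε) w) (avg (m * ε) V))),
      coeFn_avg hη (mulOp (avgBCF (m * ε) w) (avg (m * ε) V))] with x e1 e2
    rw [e1, Pi.smul_apply, e2, opA_congr hin, smul_eq_mul]
    ring
  rw [clmM_apply]
  filter_upwards [hterm, coeFn_sum (Finset.Icc 1 M) (fun m => (2 * (β m * (m : ℝ) ^ 3)) •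
    avg (m * ε) (mulOp (avgBCF (m * ε) w) (avg (m * ε) V)))] with x e1 e3
  rw [e3, opM, Finset.sum_congr rfl e1, Finset.mul_sum]

theorem coeFn_clmL (hε : 0 < ε) (V : L2) : clmL M α β w ε V =ᵐ[volume] opL M α β w ε V := by
  filter_upwards [Lp.coeFn_sub (clmB M α ε V) (clmM M β w ε V), coeFn_clmB M α hε V,
    coeFn_clmM M β w hε V] with x e1 e2 e3
  rw [opL, ← e2, ← e3]
  exact e1

theorem inner_clmL_left (U V : L2) :
    ⟪clmL M α β w ε U, V⟫_ℝ = ⟪U, clmL M α β w ε V⟫_ℝ := by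
  simp only [clmL, sub_apply, clmB_apply, clmM_apply, inner_sub_left,
    inner_sub_right, inner_add_left, inner_add_right, sum_inner, inner_sum,
    real_inner_smul_left, real_inner_smul_right, inner_avg_left, inner_mulOp_left]

theorem reflect_clmL (hw : Function.Even w) (V : L2) :
    reflect (clmL M α β w ε V) = clmL M α β w ε (reflect V) := by
  have : ∀ m : ℕ, Function.Even (avgBCF (m * ε) w) := fun m => even_opA hw _
  simp only [clmL, sub_apply, clmB_apply, clmM_apply, map_sub, map_add,
    map_sum, map_smul, reflect_avg, reflect_mulOp (this _)]

end

/-- A symmetric operator which is bounded below is an isomorphism. -/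
theorem exists_equiv_of_symmetric_of_le {H : Type*} [NormedAddCommGroup H] [InnerProductSpace ℝ H]
    [CompleteSpace H] (A : H →L[ℝ] H) (hA : ∀ x y, ⟪A x, y⟫_ℝ = ⟪x, A y⟫_ℝ) {C : ℝ}
    (hC : ∀ x, ‖x‖ ≤ C * ‖A x‖) : ∃ e : H ≃L[ℝ] H, ∀ x, e x = A x := by
  have hinj : A.ker = ⊥ := by
    rw [Submodule.eq_bot_iff]
    intro x hx
    have h := hC x
    rw [show A x = 0 from hx, norm_zero, mul_zero] at h
    exact norm_le_zero_iff.1 h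
  have hanti : AntilipschitzWith C.toNNReal A := A.antilipschitz_of_bound fun x =>
    (hC x).trans (mul_le_mul_of_nonneg_right (Real.le_coe_toNNReal C) (norm_nonneg _))
  have hclosed : IsClosed (A.range : Set H) := hanti.isClosed_range A.uniformContinuous
  have hcomplete : CompleteSpace A.range := hclosed.completeSpace_coe
  -- The range is closed, and by symmetry a vector orthogonal to it lies in the kernel, which is
  -- trivial.
  have hsurj : A.range = ⊤ := by
    rw [← Submodule.orthogonal_eq_bot_iff, Submodule.eq_bot_iff]
    intro y hy
    have h : ∀ x, ⟪x, A y⟫_ℝ = 0 := fun x => by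
      rw [← hA]
      exact (Submodule.mem_orthogonal _ _).1 hy _ ⟨x, rfl⟩
    have hAy : A y = 0 := inner_self_eq_zero.1 (h (A y))
    exact (Submodule.eq_bot_iff _).1 hinj y hAy
  exact ⟨ContinuousLinearEquiv.ofBijective A hinj hsurj, fun x => rfl⟩

theorem isClosed_evenL2 : IsClosed (evenL2 : Set L2) := by
  have : (evenL2 : Set L2) = {V | reflect V = V} := by
    ext V
    exact mem_evenL2_iff V
  rw [this]
  exact isClosed_eq reflect.continuous continuous_id

/-- Even compactly supported continuous functions are dense in `L²_even(ℝ)`. -/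
theorem exists_even_hasCompactSupport_norm_sub_le {V : L2} (hV : V ∈ evenL2) {δ : ℝ}
    (hδ : 0 < δ) : ∃ (v : ℝ → ℝ) (hv : MemLp v 2 volume), Continuous v ∧ HasCompactSupport v ∧
      Function.Even v ∧ ‖V - hv.toLp v‖ ≤ δ := by
  obtain ⟨g, hgs, hgd, hgc, hgm⟩ := (Lp.memLp V).exists_hasCompactSupport_eLpNorm_sub_le
    (by simp) (ε := ENNReal.ofReal δ) (by simpa using hδ)
  have hVg : ‖V - hgm.toLp g‖ ≤ δ := by
    have e : V - hgm.toLp g = ((Lp.memLp V).sub hgm).toLp (⇑V - g) := by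
      rw [MemLp.toLp_sub (Lp.memLp V) hgm, Lp.toLp_coeFn]
    rw [e, Lp.norm_toLp]
    exact ENNReal.toReal_le_of_le_ofReal hδ.le hgd
  have hneg := Measure.measurePreserving_neg (volume : Measure ℝ)
  have hgm' : MemLp (g ∘ Neg.neg) 2 volume := hgm.comp_measurePreserving hneg
  have href : reflect (hgm.toLp g) = hgm'.toLp (g ∘ Neg.neg) := rfl
  have hv : MemLp ((2⁻¹ : ℝ) • (g + g ∘ Neg.neg)) 2 volume := (hgm.add hgm').const_smul _
  have hgs' : HasCompactSupport (g ∘ Neg.neg) := hgs.comp_homeomorph (Homeomorph.neg ℝ)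
  -- Symmetrizing g does not increase the distance to V, because reflection is an isometry fixing V.
  refine ⟨(2⁻¹ : ℝ) • (g + g ∘ Neg.neg), hv, ?_, ?_, ?_, ?_⟩
  · exact (hgc.add (hgc.comp continuous_neg)).const_smul _
  · exact (hgs.add hgs').comp_left (g := fun y => (2⁻¹ : ℝ) • y) (by simp)
  · intro x
    simp only [Pi.smul_apply, Pi.add_apply, Function.comp_apply, neg_neg]
    rw [add_comm]
  · have e : V - hv.toLp _ = (2⁻¹ : ℝ) • ((V - hgm.toLp g) + reflect (V - hgm.toLp g)) := by
      have e1 : hv.toLp _ = (2⁻¹ : ℝ) • (hgm.toLp g + reflect (hgm.toLp g)) := by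
        rw [href]
        rfl
      rw [e1, map_sub, (mem_evenL2_iff V).1 hV]
      module
    rw [e, norm_smul]
    have h := norm_add_le (V - hgm.toLp g) (reflect (V - hgm.toLp g))
    rw [LinearIsometry.norm_map] at h
    rw [norm_inv, Real.norm_ofNat]
    linarith

end

end KdVChain

/-! ### The regularization: writing `B_ε v` as `v - T''` -/

namespace KdVChain

open Set Filter Topology
open scoped ENNReal InnerProductSpace BoundedContinuousFunction

noncomputable section

/-- The compactly supported kernel whose second derivative is the kernel of `A_η² - Id`. -/
def cubicKernel (η s : ℝ) : ℝ := (η - |s|) ^ 3 / (6 * η ^ 2)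

theorem continuous_cubicKernel (η : ℝ) : Continuous (cubicKernel η) :=
  ((continuous_const.sub continuous_abs).pow 3).div_const _

theorem cubicKernel_nonneg {η s : ℝ} (hs : s ∈ Icc (-η) η) : 0 ≤ cubicKernel η s := by
  have : 0 ≤ η - |s| := sub_nonneg.2 (abs_le.2 hs)
  rw [cubicKernel]
  positivity

section

variable {F₁ F₂ F₃ F₄ v : ℝ → ℝ}

/-- Repeated integration by parts with iterated antiderivatives of v, since v is only continuous.
The sign σ = ±1 handles the two halves of the kernel at once. -/
theorem integral_cubic_mul_comp (h1 : ∀ x, HasDerivAt F₁ (v x) x)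
    (h2 : ∀ x, HasDerivAt F₂ (F₁ x) x) (h3 : ∀ x, HasDerivAt F₃ (F₂ x) x)
    (h4 : ∀ x, HasDerivAt F₄ (F₃ x) x) (hv : Continuous v) (η x σ : ℝ) (hσ : σ ^ 2 = 1) :
    ∫ s in (0 : ℝ)..η, (η - s) ^ 3 * v (σ * s + x) =
      6 * (F₄ (σ * η + x) - F₄ x - η * σ * F₃ x - η ^ 2 / 2 * F₂ x - η ^ 3 / 6 * σ * F₁ x) := by
  have hl : ∀ s, HasDerivAt (fun s => σ * s + x) σ s := fun s => by
    simpa using ((hasDerivAt_id s).const_mul σ).add_const x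
  have hη : ∀ s, HasDerivAt (fun s => η - s) (-1) s := fun s => by
    simpa using (hasDerivAt_id s).const_sub η
  have hd : ∀ s, HasDerivAt (fun s => 6 * F₄ (σ * s + x) + 6 * σ * ((η - s) * F₃ (σ * s + x))
      + 3 * ((η - s) ^ 2 * F₂ (σ * s + x)) + σ * ((η - s) ^ 3 * F₁ (σ * s + x)))
      ((η - s) ^ 3 * v (σ * s + x)) s := by
    intro s
    have c4 := (h4 (σ * s + x)).comp s (hl s)
    have c3 := (h3 (σ * s + x)).comp s (hl s)
    have c2 := (h2 (σ * s + x)).comp s (hl s)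
    have c1 := (h1 (σ * s + x)).comp s (hl s)
    refine ((((c4.const_mul 6).add (((hη s).mul c3).const_mul (6 * σ))).add
      ((((hη s).pow 2).mul c2).const_mul 3)).add
      ((((hη s).pow 3).mul c1).const_mul σ)).congr_deriv ?_
    simp only [Function.comp_apply, Pi.pow_apply]
    push_cast
    linear_combination (6 * (η - s) * F₂ (σ * s + x) + (η - s) ^ 3 * v (σ * s + x)) * hσ
  rw [intervalIntegral.integral_eq_sub_of_hasDerivAt (fun s _ => hd s)
    (Continuous.intervalIntegrable (by fun_prop) _ _)]
  simp only [mul_zero, zero_add, sub_zero, sub_self]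
  ring

/-- Adding the two halves cancels the terms odd in σ and leaves a second difference of F₄, which is
easy to differentiate twice. -/
theorem integral_cubicKernel_mul (h1 : ∀ x, HasDerivAt F₁ (v x) x)
    (h2 : ∀ x, HasDerivAt F₂ (F₁ x) x) (h3 : ∀ x, HasDerivAt F₃ (F₂ x) x)
    (h4 : ∀ x, HasDerivAt F₄ (F₃ x) x) (hv : Continuous v) {η : ℝ} (hη : 0 < η) (x : ℝ) :
    ∫ s in (-η)..η, cubicKernel η s * v (s + x) =
      (F₄ (x + η) + F₄ (x - η) - 2 * F₄ x) / η ^ 2 - F₂ x := by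
  have hc := continuous_cubicKernel η
  have hI : ∀ a b, IntervalIntegrable (fun s => cubicKernel η s * v (s + x)) volume a b :=
    fun a b => (hc.mul (hv.comp (continuous_add_const x))).intervalIntegrable _ _
  have hneg : ∫ s in (-η)..0, cubicKernel η s * v (s + x) =
      ∫ s in (0 : ℝ)..η, cubicKernel η (-s) * v (-s + x) := by
    rw [intervalIntegral.integral_comp_neg (fun s => cubicKernel η s * v (s + x)), neg_zero]
  have hpos : ∀ σ : ℝ, σ ^ 2 = 1 → ∫ s in (0 : ℝ)..η, cubicKernel η (σ * s) * v (σ * s + x) =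
      (∫ s in (0 : ℝ)..η, (η - s) ^ 3 * v (σ * s + x)) / (6 * η ^ 2) := by
    intro σ hσ
    rw [← intervalIntegral.integral_div]
    refine intervalIntegral.integral_congr fun s hs => ?_
    rw [uIcc_of_le hη.le] at hs
    have : |σ * s| = s := by
      have hσ1 : |σ| = 1 := by
        simpa using (sq_eq_sq_iff_abs_eq_abs σ 1).1 (by rw [hσ, one_pow])
      rw [abs_mul, abs_of_nonneg hs.1, hσ1, one_mul]
    simp only [cubicKernel, this]
    ring
  have p1 := hpos 1 (by norm_num)
  have p2 := hpos (-1) (by norm_num)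
  rw [integral_cubic_mul_comp h1 h2 h3 h4 hv η x 1 (by norm_num)] at p1
  rw [integral_cubic_mul_comp h1 h2 h3 h4 hv η x (-1) (by norm_num)] at p2
  simp only [one_mul, neg_one_mul] at p1 p2
  rw [← intervalIntegral.integral_add_adjacent_intervals (hI (-η) 0) (hI 0 η), hneg, p1, p2,
    add_comm x η, show x - η = -η + x by ring]
  field_simp
  ring

end

theorem integral_cubicKernel {η : ℝ} (hη : 0 < η) :
    ∫ s in (-η)..η, cubicKernel η s = η ^ 2 / 12 := by
  -- The mass of the kernel is its convolution with the constant 1, evaluated at 0.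
  have h := integral_cubicKernel_mul (v := fun _ => 1) (F₁ := fun x => x) (F₂ := fun x => x ^ 2 / 2)
    (F₃ := fun x => x ^ 3 / 6) (F₄ := fun x => x ^ 4 / 24) hasDerivAt_id
    (fun x => ((hasDerivAt_pow 2 x).div_const 2).congr_deriv (by norm_num))
    (fun x => ((hasDerivAt_pow 3 x).div_const 6).congr_deriv (by norm_num; ring))
    (fun x => ((hasDerivAt_pow 4 x).div_const 24).congr_deriv (by norm_num; ring))
    continuous_const hη 0
  simp only [mul_one] at h
  rw [h]
  field_simp
  ring

/-- Convolution with `cubicKernel η`. -/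
def cubicConv (η : ℝ) (v : ℝ → ℝ) (x : ℝ) : ℝ := ∫ s in (-η)..η, cubicKernel η s * v (s + x)

/-- Two derivatives turn the second difference of F₄ into that of F₂, which after division by η² is
exactly A_η² v. -/
theorem exists_hasDerivAt_cubicConv {v : ℝ → ℝ} (hv : Continuous v) {η : ℝ} (hη : 0 < η) :
    ∃ g : ℝ → ℝ, (∀ x, HasDerivAt (cubicConv η v) (g x) x) ∧
      ∀ x, HasDerivAt g (opA η (opA η v) x - v x) x := by
  have cont : ∀ {F f : ℝ → ℝ}, (∀ x, HasDerivAt F (f x) x) → Continuous F := fun h =>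
    continuous_iff_continuousAt.2 fun x => (h x).continuousAt
  have h1 := hasDerivAt_integral hv
  set F₁ : ℝ → ℝ := fun x => ∫ y in (0 : ℝ)..x, v y
  have h2 := hasDerivAt_integral (cont h1)
  set F₂ : ℝ → ℝ := fun x => ∫ y in (0 : ℝ)..x, F₁ y
  have h3 := hasDerivAt_integral (cont h2)
  set F₃ : ℝ → ℝ := fun x => ∫ y in (0 : ℝ)..x, F₂ y
  have h4 := hasDerivAt_integral (cont h3)
  set F₄ : ℝ → ℝ := fun x => ∫ y in (0 : ℝ)..x, F₃ y
  have hS : cubicConv η v = fun x => (F₄ (x + η) + F₄ (x - η) - 2 * F₄ x) / η ^ 2 - F₂ x :=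
    funext fun x => integral_cubicKernel_mul h1 h2 h3 h4 hv hη x
  have shift : ∀ {F f : ℝ → ℝ}, (∀ x, HasDerivAt F (f x) x) → ∀ a x,
      HasDerivAt (fun x => F (x + a)) (f (x + a)) x := fun h a x =>
    (h (x + a)).comp_add_const x a
  have shift' : ∀ {F f : ℝ → ℝ}, (∀ x, HasDerivAt F (f x) x) → ∀ a x,
      HasDerivAt (fun x => F (x - a)) (f (x - a)) x := fun h a x =>
    (h (x - a)).comp_sub_const x a
  refine ⟨fun x => (F₃ (x + η) + F₃ (x - η) - 2 * F₃ x) / η ^ 2 - F₁ x, fun x => ?_, fun x => ?_⟩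
  · rw [hS]
    exact ((((shift h4 η x).add (shift' h4 η x)).sub ((h4 x).const_mul 2)).div_const _).sub (h2 x)
  · have hA : opA η v = fun x => (F₁ (x + η / 2) - F₁ (x - η / 2)) / η :=
      funext (opA_eq_of_hasDerivAt h1 hv η)
    have hAd : ∀ x, HasDerivAt (fun x => (F₂ (x + η / 2) - F₂ (x - η / 2)) / η) (opA η v x) x := by
      intro x
      rw [hA]
      exact ((shift h2 _ x).sub (shift' h2 _ x)).div_const _
    refine (((((shift h3 η x).add (shift' h3 η x)).sub ((h3 x).const_mul 2)).div_const _).sub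
      (h1 x)).congr_deriv ?_
    rw [opA_eq_of_hasDerivAt hAd (continuous_opA hv η), show x + η / 2 + η / 2 = x + η by ring,
      show x - η / 2 - η / 2 = x - η by ring, show x + η / 2 - η / 2 = x by ring,
      show x - η / 2 + η / 2 = x by ring]
    field_simp
    ring

theorem even_cubicConv {v : ℝ → ℝ} (hv : Function.Even v) (η : ℝ) :
    Function.Even (cubicConv η v) := by
  intro x
  rw [cubicConv, cubicConv]
  have h := intervalIntegral.integral_comp_neg (a := -η) (b := η)
    (fun s => cubicKernel η s * v (s + x))
  rw [neg_neg] at h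
  rw [← h]
  refine intervalIntegral.integral_congr fun s _ => ?_
  simp only [cubicKernel, abs_neg]
  rw [← hv, neg_add, neg_neg]

theorem hasCompactSupport_cubicConv {v : ℝ → ℝ} (hv : HasCompactSupport v) {η : ℝ} (hη : 0 < η) :
    HasCompactSupport (cubicConv η v) := by
  obtain ⟨R, hR⟩ := hv.isCompact.isBounded.subset_closedBall 0
  refine HasCompactSupport.intro (isCompact_closedBall (0 : ℝ) (R + η)) fun x hx => ?_
  rw [cubicConv]
  refine (intervalIntegral.integral_congr (g := fun _ => (0 : ℝ)) fun s hs => ?_).trans (by simp)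
  rw [uIcc_of_le (by linarith)] at hs
  have : v (s + x) = 0 := image_eq_zero_of_notMem_tsupport fun hmem => hx <| by
    have h1 := hR hmem
    rw [mem_closedBall_zero_iff, Real.norm_eq_abs] at h1 ⊢
    have h2 := abs_sub (s + x) s
    rw [add_sub_cancel_left] at h2
    have h3 := abs_le.2 hs
    linarith
  simp only [this, mul_zero]

/-- The regularization `T` with `B_ε v = v - T''`. -/
def regularization (M : ℕ) (α : ℕ → ℝ) (ε : ℝ) (v : ℝ → ℝ) (x : ℝ) : ℝ :=
  ∑ m ∈ Finset.Icc 1 M, α m * (m : ℝ) ^ 2 / ε ^ 2 * cubicConv (m * ε) v x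

section

variable (M : ℕ) (α : ℕ → ℝ) {ε : ℝ} {v : ℝ → ℝ}

theorem exists_hasDerivAt_regularization (hε : 0 < ε) (hv : Continuous v) :
    ∃ g : ℝ → ℝ, (∀ x, HasDerivAt (regularization M α ε v) (g x) x) ∧
      ∀ x, HasDerivAt g (v x - opB M α ε v x) x := by
  have key : ∀ m : ℕ, ∃ g : ℝ → ℝ, m ∈ Finset.Icc 1 M →
      (∀ x, HasDerivAt (cubicConv (m * ε) v) (g x) x) ∧
      ∀ x, HasDerivAt g (opA (m * ε) (opA (m * ε) v) x - v x) x := by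
    intro m
    by_cases hm : m ∈ Finset.Icc 1 M
    · obtain ⟨g, hg⟩ := exists_hasDerivAt_cubicConv hv (mul_pos_of_mem_Icc M hε hm)
      exact ⟨g, fun _ => hg⟩
    · exact ⟨0, fun h => absurd h hm⟩
  choose g hg using key
  refine ⟨fun x => ∑ m ∈ Finset.Icc 1 M, α m * (m : ℝ) ^ 2 / ε ^ 2 * g m x, fun x => ?_,
    fun x => ?_⟩
  · exact HasDerivAt.fun_sum fun m hm => ((hg m hm).1 x).const_mul _
  · refine (HasDerivAt.fun_sum fun m hm => ((hg m hm).2 x).const_mul _).congr_deriv ?_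
    rw [opB, sub_add_cancel_left, ← Finset.sum_neg_distrib]
    refine Finset.sum_congr rfl fun m _ => ?_
    ring

theorem continuous_opB (hv : Continuous v) : Continuous (opB M α ε v) := by
  have h : ∀ m : ℕ, Continuous (opA (m * ε) (opA (m * ε) v)) := fun m =>
    continuous_opA (continuous_opA hv _) _
  unfold opB
  fun_prop

theorem deriv_deriv_regularization (hε : 0 < ε) (hv : Continuous v) :
    deriv (deriv (regularization M α ε v)) = fun x => v x - opB M α ε v x := by
  obtain ⟨g, hg, hg'⟩ := exists_hasDerivAt_regularization M α hε hv
  rw [funext fun x => (hg x).deriv]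
  exact funext fun x => (hg' x).deriv

theorem contDiff_regularization (hε : 0 < ε) (hv : Continuous v) :
    ContDiff ℝ 2 (regularization M α ε v) := by
  obtain ⟨g, hg, hg'⟩ := exists_hasDerivAt_regularization M α hε hv
  have hd : deriv (regularization M α ε v) = g := funext fun x => (hg x).deriv
  rw [show (2 : WithTop ℕ∞) = 1 + 1 from rfl, contDiff_succ_iff_deriv]
  refine ⟨fun x => (hg x).differentiableAt, by simp, ?_⟩
  rw [hd, contDiff_one_iff_deriv]
  refine ⟨fun x => (hg' x).differentiableAt, ?_⟩
  rw [funext fun x => (hg' x).deriv]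
  exact hv.sub (continuous_opB M α hv)

theorem even_regularization (hv : Function.Even v) :
    Function.Even (regularization M α ε v) := fun x =>
  Finset.sum_congr rfl fun m _ => by rw [even_cubicConv hv]

theorem hasCompactSupport_regularization (hε : 0 < ε) (hv : HasCompactSupport v) :
    HasCompactSupport (regularization M α ε v) := by
  unfold regularization
  -- The induction runs over subsets of the index range so that mε > 0 remains available for each
  -- inserted m.
  have : ∀ s ⊆ Finset.Icc 1 M, HasCompactSupport fun x =>
      ∑ m ∈ s, α m * (m : ℝ) ^ 2 / ε ^ 2 * cubicConv (m * ε) v x := by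
    intro s
    induction s using Finset.induction_on with
    | empty =>
      simp only [Finset.sum_empty]
      exact fun _ => HasCompactSupport.zero
    | insert a s ha ih =>
      intro hs
      simp only [Finset.sum_insert ha]
      exact ((hasCompactSupport_cubicConv hv (mul_pos_of_mem_Icc M hε
        (hs (Finset.mem_insert_self a s)))).mul_left (f := fun _ => _)).add
        (ih ((Finset.subset_insert a s).trans hs))
  exact this _ le_rfl

/-- The regularization as an element of `L²(ℝ)`. -/
def regL2 (M : ℕ) (α : ℕ → ℝ) (ε : ℝ) (V : L2) : L2 :=
  ∑ m ∈ Finset.Icc 1 M, (α m * (m : ℝ) ^ 2 / ε ^ 2) •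
    kernelAvg (cubicKernel (m * ε)) (-(m * ε)) (m * ε) V

theorem coeFn_regL2 (hε : 0 < ε) {V : L2} (hV : V =ᵐ[volume] v) :
    regL2 M α ε V =ᵐ[volume] regularization M α ε v := by
  have hterm : ∀ᵐ x, ∀ m ∈ Finset.Icc 1 M, ((α m * (m : ℝ) ^ 2 / ε ^ 2) •
      kernelAvg (cubicKernel (m * ε)) (-(m * ε)) (m * ε) V : L2) x =
      α m * (m : ℝ) ^ 2 / ε ^ 2 * cubicConv (m * ε) v x := by
    rw [Filter.eventually_all_finset]
    intro m hm
    have hη := mul_pos_of_mem_Icc M hε hm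
    filter_upwards [Lp.coeFn_smul (α m * (m : ℝ) ^ 2 / ε ^ 2)
      (kernelAvg (cubicKernel (m * ε)) (-(m * ε)) (m * ε) V),
      coeFn_kernelAvg (continuous_cubicKernel (m * ε)) (show -(m * ε) ≤ m * ε by linarith) V]
      with x e1 e2
    rw [e1, Pi.smul_apply, e2, smul_eq_mul, cubicConv]
    congr 1
    refine intervalIntegral.integral_congr_ae ?_
    filter_upwards [(measurePreserving_add_right volume x).quasiMeasurePreserving.ae hV]
      with s hs _
    rw [hs]
  filter_upwards [hterm, coeFn_sum (Finset.Icc 1 M) (fun m => (α m * (m : ℝ) ^ 2 / ε ^ 2) •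
    kernelAvg (cubicKernel (m * ε)) (-(m * ε)) (m * ε) V)] with x e1 e2
  rw [regL2, e2, regularization, Finset.sum_congr rfl e1]

/-- The m-th kernel is nonnegative of mass (mε)²/12, so with its prefactor it has mass α_m m⁴/12,
and only translations by at most Mε enter. -/
theorem norm_regL2_sub_le (hα : ∀ m ∈ Finset.Icc 1 M, 0 < α m) (hε : 0 < ε) {V : L2} {δ : ℝ}
    (hδ : ∀ s, |s| ≤ M * ε → ‖translate s V - V‖ ≤ δ) :
    ‖regL2 M α ε V - ((∑ m ∈ Finset.Icc 1 M, α m * (m : ℝ) ^ 4) / 12) • V‖ ≤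
      (∑ m ∈ Finset.Icc 1 M, α m * (m : ℝ) ^ 4) / 12 * δ := by
  have hterm : ∀ m ∈ Finset.Icc 1 M, ‖(α m * (m : ℝ) ^ 2 / ε ^ 2) •
      kernelAvg (cubicKernel (m * ε)) (-(m * ε)) (m * ε) V - (α m * (m : ℝ) ^ 4 / 12) • V‖ ≤
      α m * (m : ℝ) ^ 4 / 12 * δ := by
    intro m hm
    have hη := mul_pos_of_mem_Icc M hε hm
    have hmM : (m : ℝ) * ε ≤ M * ε :=
      mul_le_mul_of_nonneg_right (by exact_mod_cast (Finset.mem_Icc.1 hm).2) hε.le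
    have h := norm_kernelAvg_sub_le (continuous_cubicKernel (m * ε))
      (show -(m * ε) ≤ m * ε by linarith) (fun s hs => cubicKernel_nonneg hs) (V := V) (U := V)
      (fun s hs => hδ s ((abs_le.2 hs).trans hmM))
    rw [integral_cubicKernel hη] at h
    have hk : 0 ≤ α m * (m : ℝ) ^ 2 / ε ^ 2 := by
      have := hα m hm
      positivity
    have e : α m * (m : ℝ) ^ 4 / 12 = α m * (m : ℝ) ^ 2 / ε ^ 2 * ((m * ε) ^ 2 / 12) := by
      field_simp
    rw [e, mul_smul, ← smul_sub, norm_smul, Real.norm_of_nonneg hk, mul_assoc]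
    exact mul_le_mul_of_nonneg_left h hk
  rw [regL2, Finset.sum_div, Finset.sum_smul, ← Finset.sum_sub_distrib, Finset.sum_mul]
  exact norm_sum_le_of_le _ hterm

end

end

end KdVChain

/-! ### Uniform estimate for `L_ε` and the conclusion -/

namespace KdVChain

open Set Filter Topology
open scoped ENNReal InnerProductSpace BoundedContinuousFunction

noncomputable section

theorem norm_sq_eq_integral {F : L2} {f : ℝ → ℝ} (h : F =ᵐ[volume] f) :
    ‖F‖ ^ 2 = ∫ x, f x ^ 2 := by
  rw [← real_inner_self_eq_norm_sq, L2.inner_def]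
  refine integral_congr_ae ?_
  filter_upwards [h] with x hx
  rw [hx]
  simp [sq]

section

variable {M : ℕ} {α β : ℕ → ℝ} {w : ℝ →ᵇ ℝ} {ε : ℝ}

/-- Expand ⟪V, B_ε V⟫: each term is nonnegative since averages are contractions, so the term m = 1
alone is bounded by ‖V‖ ‖B_ε V‖. -/
theorem norm_sq_sub_norm_avg_sq_le (hM : 1 ≤ M) (hα : ∀ m ∈ Finset.Icc 1 M, 0 < α m) (hε : 0 < ε)
    (V : L2) : ‖V‖ ^ 2 - ‖avg ε V‖ ^ 2 ≤
      (ε / √(α 1) * (‖V‖ + ‖clmB M α ε V‖)) ^ 2 := by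
  have h1mem : 1 ∈ Finset.Icc 1 M := Finset.mem_Icc.2 ⟨le_rfl, hM⟩
  have hα1 := hα 1 h1mem
  have hinner : ⟪V, clmB M α ε V⟫_ℝ = ‖V‖ ^ 2 + ∑ m ∈ Finset.Icc 1 M,
      α m * (m : ℝ) ^ 2 / ε ^ 2 * (‖V‖ ^ 2 - ‖avg (m * ε) V‖ ^ 2) := by
    rw [clmB_apply, inner_add_right, inner_sum, real_inner_self_eq_norm_sq]
    congr 1
    refine Finset.sum_congr rfl fun m _ => ?_
    rw [real_inner_smul_right, inner_sub_right, ← inner_avg_left, real_inner_self_eq_norm_sq,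
      real_inner_self_eq_norm_sq]
  have hnonneg : ∀ m ∈ Finset.Icc 1 M,
      0 ≤ α m * (m : ℝ) ^ 2 / ε ^ 2 * (‖V‖ ^ 2 - ‖avg (m * ε) V‖ ^ 2) := by
    intro m hm
    have h1 := hα m hm
    have h2 : 0 ≤ ‖V‖ ^ 2 - ‖avg (m * ε) V‖ ^ 2 :=
      sub_nonneg.2 (pow_le_pow_left₀ (norm_nonneg _) (norm_avg_le _ _) 2)
    positivity
  have hsingle := Finset.single_le_sum hnonneg h1mem
  have hcs := real_inner_le_norm V (clmB M α ε V)
  rw [hinner] at hcs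
  simp only [Nat.cast_one, one_pow, mul_one, one_mul] at hsingle
  have hle : α 1 / ε ^ 2 * (‖V‖ ^ 2 - ‖avg ε V‖ ^ 2) ≤ (‖V‖ + ‖clmB M α ε V‖) ^ 2 := by
    nlinarith [norm_nonneg V, norm_nonneg (clmB M α ε V), sq_nonneg ‖V‖,
      sq_nonneg ‖clmB M α ε V‖, mul_nonneg (norm_nonneg V) (norm_nonneg (clmB M α ε V))]
  rw [mul_pow, div_pow, Real.sq_sqrt hα1.le]
  calc ‖V‖ ^ 2 - ‖avg ε V‖ ^ 2
      = ε ^ 2 / α 1 * (α 1 / ε ^ 2 * (‖V‖ ^ 2 - ‖avg ε V‖ ^ 2)) := by field_simp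
    _ ≤ _ := mul_le_mul_of_nonneg_left hle (by positivity)

theorem norm_clmM_le (hβ : ∀ m ∈ Finset.Icc 1 M, 0 < β m) (V : L2) :
    ‖clmM M β w ε V‖ ≤ 2 * (∑ m ∈ Finset.Icc 1 M, β m * (m : ℝ) ^ 3) * ‖w‖ * ‖V‖ := by
  rw [clmM_apply, Finset.mul_sum, Finset.sum_mul, Finset.sum_mul]
  refine norm_sum_le_of_le _ fun m hm => ?_
  have hk : 0 ≤ 2 * (β m * (m : ℝ) ^ 3) := by
    have := hβ m hm
    positivity
  rw [norm_smul, Real.norm_of_nonneg hk, mul_assoc _ ‖w‖]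
  refine mul_le_mul_of_nonneg_left ?_ hk
  refine (norm_avg_le _ _).trans ((norm_mulOp_le _ _).trans ?_)
  exact mul_le_mul (norm_avgBCF_le _ _) (norm_avg_le _ _) (norm_nonneg _) (norm_nonneg _)

/-- The inner average, the average of the potential and the outer average are removed one at a time.
-/
theorem norm_avg_mulOp_avg_sub_le {K : ℝ} (hK : ∀ x y, |w x - w y| ≤ K * |x - y|) (hK0 : 0 ≤ K)
    {η δ : ℝ} (hη : 0 < η) {V : L2} (hδ : ∀ s, |s| ≤ η → ‖translate s V - V‖ ≤ δ) :
    ‖avg η (mulOp (avgBCF η w) (avg η V)) - mulOp w V‖ ≤ 2 * (‖w‖ * δ + K * η * ‖V‖) := by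
  have h1 : ‖avg η (mulOp (avgBCF η w) (avg η V - V))‖ ≤ ‖w‖ * δ := by
    refine (norm_avg_le _ _).trans ((norm_mulOp_le _ _).trans ?_)
    exact mul_le_mul (norm_avgBCF_le _ _)
      (norm_avg_sub_le hη fun s hs => hδ s (by linarith)) (norm_nonneg _) (norm_nonneg _)
  have h2 : ‖avg η (mulOp (avgBCF η w) V - mulOp w V)‖ ≤ K * η * ‖V‖ := by
    refine (norm_avg_le _ _).trans (norm_mulOp_sub_mulOp_le (fun x => ?_) V)
    refine abs_opA_sub_le w.continuous hη fun s hs => (hK (s + x) x).trans ?_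
    rw [add_sub_cancel_right]
    exact mul_le_mul_of_nonneg_left (by linarith) hK0
  have h3 : ‖avg η (mulOp w V) - mulOp w V‖ ≤ K * η * ‖V‖ + ‖w‖ * δ := by
    refine norm_avg_sub_le hη fun s hs => (norm_translate_mulOp_sub_le hK s V).trans ?_
    have hs' : |s| ≤ η := by linarith
    exact add_le_add (mul_le_mul_of_nonneg_right (mul_le_mul_of_nonneg_left hs' hK0)
      (norm_nonneg _)) (mul_le_mul_of_nonneg_left (hδ s hs') (norm_nonneg _))
  have e : avg η (mulOp (avgBCF η w) (avg η V)) - mulOp w V =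
      avg η (mulOp (avgBCF η w) (avg η V - V)) + avg η (mulOp (avgBCF η w) V - mulOp w V) +
        (avg η (mulOp w V) - mulOp w V) := by
    simp only [map_sub]
    abel
  rw [e]
  refine (norm_add₃_le).trans ?_
  linarith

theorem norm_clmM_sub_le (hβ : ∀ m ∈ Finset.Icc 1 M, 0 < β m) {K : ℝ}
    (hK : ∀ x y, |w x - w y| ≤ K * |x - y|) (hK0 : 0 ≤ K) (hε : 0 < ε) {δ : ℝ} {V : L2}
    (hδ : ∀ s, |s| ≤ M * ε → ‖translate s V - V‖ ≤ δ) :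
    ‖clmM M β w ε V - (2 * ∑ m ∈ Finset.Icc 1 M, β m * (m : ℝ) ^ 3) • mulOp w V‖ ≤
      2 * (∑ m ∈ Finset.Icc 1 M, β m * (m : ℝ) ^ 3) *
        (2 * (‖w‖ * δ + K * (M * ε) * ‖V‖)) := by
  rw [clmM_apply, Finset.mul_sum, Finset.sum_smul, ← Finset.sum_sub_distrib, Finset.sum_mul]
  refine norm_sum_le_of_le _ fun m hm => ?_
  have hη := mul_pos_of_mem_Icc M hε hm
  have hmM : (m : ℝ) * ε ≤ M * ε :=
    mul_le_mul_of_nonneg_right (by exact_mod_cast (Finset.mem_Icc.1 hm).2) hε.le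
  have hk : 0 ≤ 2 * (β m * (m : ℝ) ^ 3) := by
    have := hβ m hm
    positivity
  rw [← smul_sub, norm_smul, Real.norm_of_nonneg hk]
  refine mul_le_mul_of_nonneg_left ((norm_avg_mulOp_avg_sub_le hK hK0 hη fun s hs =>
    hδ s (hs.trans hmM)).trans ?_) hk
  gcongr

/-- The a priori estimate for even compactly supported continuous functions. -/
theorem norm_le_of_hasCompactSupport (hα : ∀ m ∈ Finset.Icc 1 M, 0 < α m)
    (hβ : ∀ m ∈ Finset.Icc 1 M, 0 < β m)
    {c b : ℝ} (hc : c = (∑ m ∈ Finset.Icc 1 M, α m * (m : ℝ) ^ 4) / 12) (hc0 : 0 < c)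
    (hb : b = ∑ m ∈ Finset.Icc 1 M, β m * (m : ℝ) ^ 3) (hb0 : 0 < b) {C : ℝ} (hC0 : 0 ≤ C)
    (hC : ∀ T : ℝ → ℝ, ContDiff ℝ 2 T → HasCompactSupport T → Function.Even T →
      ∫ x, T x ^ 2 ≤ C * ∫ x, (T x - c * deriv (deriv T) x - 2 * b * w x * T x) ^ 2)
    {K : ℝ} (hK : ∀ x y, |w x - w y| ≤ K * |x - y|) (hK0 : 0 ≤ K) (hε : 0 < ε) {δ : ℝ}
    {v : ℝ → ℝ} (hv : MemLp v 2 volume) (hvc : Continuous v) (hvs : HasCompactSupport v)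
    (hve : Function.Even v)
    (hδ : ∀ s, |s| ≤ M * ε → ‖translate s (hv.toLp v) - hv.toLp v‖ ≤ δ) :
    ‖hv.toLp v‖ ≤ δ + √C * (δ + ‖clmL M α β w ε (hv.toLp v)‖ +
      2 * b * (2 * (‖w‖ * δ + K * (M * ε) * ‖hv.toLp v‖)) + 2 * b * ‖w‖ * δ) := by
  set V := hv.toLp v with hV
  have hVv : V =ᵐ[volume] v := hv.coeFn_toLp
  set T := regularization M α ε v with hT
  set TE := regL2 M α ε V with hTE
  have hTEae : TE =ᵐ[volume] T := coeFn_regL2 M α hε hVv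
  have hdiff : ‖TE - c • V‖ ≤ c * δ := by
    rw [hc]
    exact norm_regL2_sub_le M α hα hε hδ
  -- This is T - c T'' - 2b w T as an element of L², using T'' = v - B_ε v.
  set H : L2 := TE - c • V + c • clmB M α ε V - (2 * b) • mulOp w TE with hH
  have hBae : clmB M α ε V =ᵐ[volume] opB M α ε v := by
    filter_upwards [coeFn_clmB M α hε V, hVv] with x e1 e2
    rw [e1, opB, opB, e2]
    simp only [opA_congr hVv]
  have hHae : H =ᵐ[volume] fun x => T x - c * deriv (deriv T) x - 2 * b * w x * T x := by
    filter_upwards [Lp.coeFn_sub (TE - c • V + c • clmB M α ε V) ((2 * b) • mulOp w TE),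
      Lp.coeFn_add (TE - c • V) (c • clmB M α ε V), Lp.coeFn_sub TE (c • V), Lp.coeFn_smul c V,
      Lp.coeFn_smul c (clmB M α ε V), Lp.coeFn_smul (2 * b) (mulOp w TE), coeFn_mulOp w TE,
      hTEae, hBae, hVv] with x e1 e2 e3 e4 e5 e6 e7 e8 e9 e10
    rw [hH, e1, Pi.sub_apply, e2, Pi.add_apply, e3, Pi.sub_apply, e4, e5, e6, Pi.smul_apply,
      Pi.smul_apply, Pi.smul_apply, e7, e8, e9, e10, hT, deriv_deriv_regularization M α hε hvc]
    simp only [smul_eq_mul]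
    ring
  have hTH : ‖TE‖ ≤ √C * ‖H‖ := by
    have h := hC T (contDiff_regularization M α hε hvc)
      (hasCompactSupport_regularization M α hε hvs) (even_regularization M α hve)
    rw [← norm_sq_eq_integral hTEae, ← norm_sq_eq_integral hHae] at h
    refine abs_le_of_sq_le_sq' ?_ (by positivity) |>.2
    rwa [mul_pow, Real.sq_sqrt hC0]
  set D := clmM M β w ε V - (2 * b) • mulOp w V with hD
  have hDle : ‖D‖ ≤ 2 * b * (2 * (‖w‖ * δ + K * (M * ε) * ‖V‖)) := by
    rw [hD, hb]
    exact norm_clmM_sub_le hβ hK hK0 hε hδ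
  -- Substituting B_ε = L_ε + M_ε cancels the leading terms 2bc w V; what remains is c L_ε V and
  -- small errors.
  have hHeq : H = (TE - c • V) + c • clmL M α β w ε V + c • D
      - (2 * b) • mulOp w (TE - c • V) := by
    rw [hH, hD, map_sub, map_smul, clmL, sub_apply]
    module
  have hHle : ‖H‖ ≤ c * (δ + ‖clmL M α β w ε V‖ +
      2 * b * (2 * (‖w‖ * δ + K * (M * ε) * ‖V‖)) + 2 * b * ‖w‖ * δ) := by
    have h1 := norm_sub_le ((TE - c • V) + c • clmL M α β w ε V + c • D)
      ((2 * b) • mulOp w (TE - c • V))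
    have h2 : ‖(TE - c • V) + c • clmL M α β w ε V + c • D‖ ≤ _ := norm_add₃_le
    have h3 := (norm_mulOp_le w (TE - c • V)).trans
      (mul_le_mul_of_nonneg_left hdiff (norm_nonneg w))
    have h4 := mul_le_mul_of_nonneg_left h3 (show 0 ≤ 2 * b by positivity)
    have h5 := mul_le_mul_of_nonneg_left hDle hc0.le
    rw [← hHeq] at h1
    simp only [norm_smul, Real.norm_of_nonneg hc0.le,
      Real.norm_of_nonneg (show 0 ≤ 2 * b by positivity)] at h1 h2
    linarith
  have hcV : c * ‖V‖ ≤ ‖TE‖ + c * δ := by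
    have h := norm_sub_norm_le (c • V) TE
    rw [norm_sub_rev, norm_smul, Real.norm_of_nonneg hc0.le] at h
    linarith
  refine le_of_mul_le_mul_left ?_ hc0
  have h6 := mul_le_mul_of_nonneg_left hHle (Real.sqrt_nonneg C)
  linarith

/-- The uniform lower bound for `L_ε` on even functions. -/
theorem exists_forall_norm_le (hM : 1 ≤ M) (hα : ∀ m ∈ Finset.Icc 1 M, 0 < α m)
    (hβ : ∀ m ∈ Finset.Icc 1 M, 0 < β m)
    (hw : IsWaveProfile ((∑ m ∈ Finset.Icc 1 M, α m * (m : ℝ) ^ 4) / 12)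
      (∑ m ∈ Finset.Icc 1 M, β m * (m : ℝ) ^ 3) w) :
    ∃ εs : ℝ, 0 < εs ∧ εs ≤ 1 ∧ ∃ C : ℝ, ∀ ε : ℝ, 0 < ε → ε ≤ εs → ∀ V ∈ evenL2,
      ‖V‖ ≤ C * ‖clmL M α β w ε V‖ := by
  have hc0 := hw.c_pos
  have hb0 := hw.b_pos
  obtain ⟨C, hC0, hC⟩ := hw.exists_integral_sq_le
  obtain ⟨K, hK0, -, hKd⟩ := hw.exists_bound
  have hK : ∀ x y, |w x - w y| ≤ K * |x - y| := fun x y =>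
    convex_univ.norm_image_sub_le_of_norm_deriv_le (f := w) (C := K)
      (fun z _ => (hw.hasDerivAt z).differentiableAt) (fun z _ => hKd z) (mem_univ y) (mem_univ x)
  set c := (∑ m ∈ Finset.Icc 1 M, α m * (m : ℝ) ^ 4) / 12 with hc
  set b := ∑ m ∈ Finset.Icc 1 M, β m * (m : ℝ) ^ 3 with hb
  -- Coefficients of ε(‖V‖ + ‖L_ε V‖): K₁ for translations by at most Mε, K₂ for replacing M_ε by
  -- its limit, K₃ for the total error.
  set K₁ := 6 * M * ((1 + 2 * b * ‖w‖) / √(α 1)) with hK₁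
  have hK₁0 : 0 ≤ K₁ := by positivity
  set K₂ := 2 * b * (2 * (‖w‖ * K₁ + K * M)) with hK₂
  have hK₂0 : 0 ≤ K₂ := by positivity
  set K₃ := K₁ + √C * (K₁ + K₂ + 2 * b * ‖w‖ * K₁) with hK₃
  have hK₃0 : 0 ≤ K₃ := by positivity
  have hdense : ∀ ε : ℝ, 0 < ε → ∀ V ∈ evenL2,
      ‖V‖ ≤ K₃ * ε * (‖V‖ + ‖clmL M α β w ε V‖) + √C * ‖clmL M α β w ε V‖ := by
    intro ε hε
    -- For fixed ε both sides are continuous in V, so the inequality passes from the dense set of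
    -- even compactly supported continuous functions to all of `evenL2`.
    have hclosed : IsClosed {V : L2 |
        ‖V‖ ≤ K₃ * ε * (‖V‖ + ‖clmL M α β w ε V‖) + √C * ‖clmL M α β w ε V‖} :=
      isClosed_le (by fun_prop) (by fun_prop)
    intro V hV
    refine hclosed.closure_subset (Metric.mem_closure_iff.2 fun r hr => ?_)
    obtain ⟨v, hv, hvc, hvs, hve, hVv⟩ :=
      exists_even_hasCompactSupport_norm_sub_le hV (half_pos hr)
    refine ⟨hv.toLp v, ?_, by rw [dist_eq_norm]; linarith⟩
    set U := hv.toLp v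
    set G := clmL M α β w ε U with hG
    have hB : ‖clmB M α ε U‖ ≤ 2 * b * ‖w‖ * ‖U‖ + ‖G‖ := by
      have e : clmB M α ε U = clmM M β w ε U + G := by
        rw [hG, clmL, sub_apply, add_sub_cancel]
      rw [e]
      exact (norm_add_le _ _).trans (add_le_add_left (norm_clmM_le hβ U) _)
    have hδ : ∀ s, |s| ≤ M * ε → ‖translate s U - U‖ ≤ K₁ * ε * (‖U‖ + ‖G‖) := by
      intro s hs
      refine (norm_translate_sub_le hε hM hs (by positivity)
        (norm_sq_sub_norm_avg_sq_le hM hα hε U)).trans ?_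
      have h1 : ‖U‖ + ‖clmB M α ε U‖ ≤ (1 + 2 * b * ‖w‖) * (‖U‖ + ‖G‖) := by
        have := mul_nonneg (show 0 ≤ 2 * b * ‖w‖ by positivity) (norm_nonneg G)
        linarith
      calc 6 * M * (ε / √(α 1) * (‖U‖ + ‖clmB M α ε U‖))
          ≤ 6 * M * (ε / √(α 1) * ((1 + 2 * b * ‖w‖) * (‖U‖ + ‖G‖))) := by gcongr
        _ = K₁ * ε * (‖U‖ + ‖G‖) := by rw [hK₁]; ring
    have h := norm_le_of_hasCompactSupport hα hβ hc hc0 hb hb0 hC0 hC hK hK0.le hε hv hvc hvs hve hδ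
    change ‖U‖ ≤ _ at h
    refine h.trans ?_
    have h2 : K * (M * ε) * ‖U‖ ≤ K * (M * ε) * (‖U‖ + ‖G‖) := by
      gcongr
      exact le_add_of_nonneg_right (norm_nonneg _)
    have h3 : 2 * b * (2 * (‖w‖ * (K₁ * ε * (‖U‖ + ‖G‖)) + K * (M * ε) * ‖U‖)) ≤
        K₂ * ε * (‖U‖ + ‖G‖) := by
      have := mul_le_mul_of_nonneg_left h2 (show 0 ≤ 2 * b * 2 by positivity)
      rw [hK₂]
      linarith
    have h4 := mul_le_mul_of_nonneg_left h3 (Real.sqrt_nonneg C)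
    change _ ≤ K₃ * ε * (‖U‖ + ‖G‖) + √C * ‖G‖
    rw [hK₃]
    linarith
  -- This threshold gives K₃ ε ≤ 1/2; absorbing ‖V‖/2 on the left leaves the constant 1 + 2√C.
  refine ⟨min 1 (1 / (2 * (K₃ + 1))), by positivity, min_le_left _ _, 1 + 2 * √C,
    fun ε hε hεs V hV => ?_⟩
  have h1 := hdense ε hε V hV
  have h2 : K₃ * ε ≤ 1 / 2 := by
    have h3 : ε ≤ 1 / (2 * (K₃ + 1)) := hεs.trans (min_le_right _ _)
    rw [le_div_iff₀ (by positivity)] at h3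
    linarith
  have h4 := mul_le_mul_of_nonneg_right h2
    (add_nonneg (norm_nonneg V) (norm_nonneg (clmL M α β w ε V)))
  linarith

end

theorem IsKdVWave.isWaveProfile {M : ℕ} (hM : 1 ≤ M) {α β : ℕ → ℝ}
    (hα : ∀ m ∈ Finset.Icc 1 M, 0 < α m) (hβ : ∀ m ∈ Finset.Icc 1 M, 0 < β m) {W₀ : ℝ → ℝ}
    (h : IsKdVWave M α β W₀) :
    IsWaveProfile ((∑ m ∈ Finset.Icc 1 M, α m * (m : ℝ) ^ 4) / 12)
      (∑ m ∈ Finset.Icc 1 M, β m * (m : ℝ) ^ 3) W₀ where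
  c_pos := by
    refine div_pos (Finset.sum_pos (fun m hm => ?_) (Finset.nonempty_Icc.2 hM)) (by norm_num)
    have h1 : (0 : ℝ) < m := by exact_mod_cast (Finset.mem_Icc.1 hm).1
    have := hα m hm
    positivity
  b_pos := by
    refine Finset.sum_pos (fun m hm => ?_) (Finset.nonempty_Icc.2 hM)
    have h1 : (0 : ℝ) < m := by exact_mod_cast (Finset.mem_Icc.1 hm).1
    have := hβ m hm
    positivity
  contDiff := h.contDiff
  memLp := h.memLp
  even := h.even
  ne_zero := h.ne_zero
  ode := h.ode

end

end KdVChain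

theorem theorem3p3 (M : ℕ) (hM : 1 ≤ M) (α β : ℕ → ℝ)
    (hα : ∀ m ∈ Finset.Icc 1 M, 0 < α m) (hβ : ∀ m ∈ Finset.Icc 1 M, 0 < β m)
    (W₀ : ℝ → ℝ) (hW₀ : KdVChain.IsKdVWave M α β W₀) :
    ∃ εs : ℝ, 0 < εs ∧ εs ≤ 1 ∧ ∃ C : ℝ, ∀ ε : ℝ, 0 < ε → ε ≤ εs →
      ∃ L : KdVChain.evenL2 ≃L[ℝ] KdVChain.evenL2,
        (∀ V : KdVChain.evenL2,
          ((L V : Lp ℝ 2 (volume : Measure ℝ)) : ℝ → ℝ) =ᵐ[volume]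
            KdVChain.opL M α β W₀ ε ((V : Lp ℝ 2 (volume : Measure ℝ)) : ℝ → ℝ)) ∧
        ∀ G : KdVChain.evenL2, ‖L.symm G‖ ≤ C * ‖G‖ := by
  have hprof := hW₀.isWaveProfile hM hα hβ
  obtain ⟨K, -, hWK, -⟩ := hprof.exists_bound
  obtain ⟨w, rfl⟩ : ∃ w : BoundedContinuousFunction ℝ ℝ, ⇑w = W₀ :=
    ⟨BoundedContinuousFunction.ofNormedAddCommGroup W₀ hW₀.contDiff.continuous K fun x => by
      rw [Real.norm_of_nonneg (hprof.nonneg x)]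
      exact hWK x, rfl⟩
  obtain ⟨εs, h0, h1, C, hC⟩ := KdVChain.exists_forall_norm_le hM hα hβ hprof
  refine ⟨εs, h0, h1, C, fun ε hε hεs => ?_⟩
  have hmaps : ∀ V : KdVChain.evenL2, KdVChain.clmL M α β w ε V ∈ KdVChain.evenL2 := fun V => by
    rw [KdVChain.mem_evenL2_iff, KdVChain.reflect_clmL M α β w hprof.even,
      (KdVChain.mem_evenL2_iff _).1 V.2]
  have hcomplete : CompleteSpace KdVChain.evenL2 := KdVChain.isClosed_evenL2.completeSpace_coe
  -- Invertibility is obtained on the even subspace itself, a Hilbert space preserved by `L_ε`,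
  -- because the lower bound holds only there.
  obtain ⟨L, hL⟩ := KdVChain.exists_equiv_of_symmetric_of_le
    (((KdVChain.clmL M α β w ε).comp KdVChain.evenL2.subtypeL).codRestrict KdVChain.evenL2 hmaps)
    (fun U V => KdVChain.inner_clmL_left M α β w (U : Lp ℝ 2 (volume : Measure ℝ)) V)
    (fun V => hC ε hε hεs V V.2)
  refine ⟨L, fun V => ?_, fun G => ?_⟩
  · rw [hL V]
    exact KdVChain.coeFn_clmL M α β w hε V
  · have h := hC ε hε hεs (L.symm G) (L.symm G).2
    have e : KdVChain.clmL M α β w ε (L.symm G) = G := by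
      have := hL (L.symm G)
      rw [L.apply_symm_apply] at this
      exact (congrArg Subtype.val this).symm
    rw [e] at h
    exact h
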